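/- For each sample size $n$ consider variable selection in the regression $y\sim N(X\theta,\phi I_n)$, where $X$ is an $n\times p$ matrix ($p$ may depend on $n$), over a set of candidate models $M_k$. Each model is a subset of $p_k$ columns, with design matrix $X_k$ and $X_k'X_k$ invertible; let $\bar p=\max_k p_k$. Prior model probabilities $p(M_k)>0$ depend on $k$ only through $p_k$. Given $M_k$, the prior is the pMOM prior $$p(\theta_k\mid\phi,M_k)=N(\theta_k;0,\tau\phi V_k)\prod_{j\in M_k}\frac{\theta_j^2\,x_j'x_j}{\tau\phi},\qquad V_k=\mathrm{diag}(X_k'X_k)^{-1},$$ with dispersion $\tau>0$ (which may depend on $n$), and $\phi\sim \mathrm{IG}(a_\phi/2,l_\phi/2)$ with fixed $a_\phi,l_\phi>0$. The data are generated from $f^*=N(X_t\theta_t^*,\phi^*I_n)$ for a candidate model $M_t$ with $p_t\ge 1$. Let $M_m$ be a spurious candidate model, i.e. $M_t\subsetneq M_m$. All these quantities may depend on $n$. Write $r_{p_m,p_t}=p(M_m)/p(M_t)$, let $\rho_{k1}\ge\dots\ge\rho_{kp_k}$ be the eigenvalues of $V_kX_k'X_k$, let $\lambda_{t0}=(X_t\theta_t^*)'(X_t\theta_t^*)/\phi^*$,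 and let $a_n\ll b_n$ mean $a_n/b_n\to0$ as $n\to\infty$. Let $$D_{mt}=\frac{E_m}{E_t},\qquad E_k=\int\!\!\int \prod_{j\in M_k}\frac{\theta_j^2\,x_j'x_j}{\tau\phi}\;N(\theta_k;\tilde\theta_k,\phi\tilde V_k)\,\mathrm{IG}\!\left(\phi;\tfrac{a_\phi+n}{2},\tfrac{\tilde s_k}{2}\right)d\theta_k\,d\phi,$$ where $\tilde V_k^{-1}=X_k'X_k+V_k^{-1}/\tau$, $\tilde\theta_k=\tilde V_kX_k'y$ and $\tilde s_k=l_\phi+y'y-y'X_k\tilde V_kX_k'y$. Assume: (B1) $\bar p\ll\min\{n,p\}$ and $\tau\gg\bar p$; (C1) $\tau\gg1$ and $r_{p_m,p_t}\ll\tau^{\beta_2(p_m-p_t)/2}$ for some fixed $\beta_2\in(0,1)$; (D1) for some constant $c>0$, $\prod_{j=1}^{p_m}(\tau\rho_{mj}+1)^{1/2}\big/\prod_{j=1}^{p_t}(\tau\rho_{tj}+1)^{1/2}\asymp(c\tau)^{(p_m-p_t)/2}$; (D2) $\lambda_{t0}\ll\tau\rho_{tp_t}$. Then for every sequence $h_n\to\infty$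 and all fixed $\alpha\in(0,1)$ and $\kappa>0$ there is a sequence $$b_n\ll\max\left\{r_{p_m,p_t}^{\alpha}\,(h_n\sqrt\tau)^{\alpha(p_t-p_m)},\;e^{-\kappa n},\;e^{-\tau\rho_{tp_t}/2}\right\}$$ such that, for all sufficiently large $n$, $$E_{f^*}\big(p(M_m\mid y)\big)\le b_n+P_{f^*}\!\left(D_{mt}>h_n^{-(p_m-p_t)}\right).$$ -/

import Mathlib

open MeasureTheory ProbabilityTheory Filter Topology Asymptotics
open scoped BigOperators Matrix

noncomputable section

namespace MomSelection

/-- Density at `x` of the multivariate normal law with mean `μ` and covariance matrix `S`. -/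
def normalPDF {ι : Type*} [Fintype ι] [DecidableEq ι]
    (μ : ι → ℝ) (S : Matrix ι ι ℝ) (x : ι → ℝ) : ℝ :=
  Real.exp (-(1 / 2) * ((x - μ) ⬝ᵥ (S⁻¹ *ᵥ (x - μ)))) /
    Real.sqrt ((2 * Real.pi) ^ Fintype.card ι * S.det)

/-- Density at `φ > 0` of the inverse gamma law with shape `a` and scale `b`. -/
def invGammaPDF (a b φ : ℝ) : ℝ :=
  b ^ a / Real.Gamma a * φ ^ (-a - 1) * Real.exp (-b / φ)

section Model

variable {n p : ℕ} (X : Matrix (Fin n) (Fin p) ℝ) (k : Finset (Fin p))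

/-- The design matrix `X_k` of the model that selects the columns in `k`. -/
def design : Matrix (Fin n) k ℝ := X.submatrix id (fun j => (j : Fin p))

/-- The Gram matrix `X_k' X_k`. -/
def gram : Matrix k k ℝ := (design X k)ᵀ * design X k

/-- The prior scale matrix `V_k = diag(X_k' X_k)⁻¹`. -/
def priorScale : Matrix k k ℝ := (Matrix.diagonal fun j => gram X k j j)⁻¹

/-- The MOM penalty `∏_{j ∈ k} θ_j² x_j'x_j / (τ φ)`. -/
def penalty (τ φ : ℝ) (θ : k → ℝ) : ℝ :=
  ∏ j, θ j ^ 2 * gram X k j j / (τ * φ)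

/-- The pMOM prior density of `θ_k` given `φ`. -/
def pMOM (τ φ : ℝ) (θ : k → ℝ) : ℝ :=
  normalPDF 0 ((τ * φ) • priorScale X k) θ * penalty X k τ φ θ

/-- The integrated likelihood `p(y | M_k)` for Gaussian errors with variance `φ`,
under the pMOM prior on `θ_k` given `φ` and an `IG(a / 2, l / 2)` prior on `φ`. -/
def marginalLik (τ a l : ℝ) (y : Fin n → ℝ) : ℝ :=
  ∫ φ in Set.Ioi (0 : ℝ), ∫ θ : k → ℝ,
    normalPDF (design X k *ᵥ θ) (φ • (1 : Matrix (Fin n) (Fin n) ℝ)) y *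
      pMOM X k τ φ θ * invGammaPDF (a / 2) (l / 2) φ

/-- The posterior probability `p(M_k | y)` over the candidate set `models`, with prior model
probabilities `prior`. -/
def postProb (models : Finset (Finset (Fin p))) (prior : Finset (Fin p) → ℝ)
    (τ a l : ℝ) (y : Fin n → ℝ) : ℝ :=
  marginalLik X k τ a l y * prior k / ∑ i ∈ models, marginalLik X i τ a l y * prior i

/-- `Ṽ_k = (X_k'X_k + V_k⁻¹ / τ)⁻¹`. -/
def postScale (τ : ℝ) : Matrix k k ℝ := (gram X k + τ⁻¹ • (priorScale X k)⁻¹)⁻¹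

/-- `θ̃_k = Ṽ_k X_k' y`. -/
def postMean (τ : ℝ) (y : Fin n → ℝ) : k → ℝ :=
  postScale X k τ *ᵥ ((design X k)ᵀ *ᵥ y)

/-- `s̃_k = l + y'y - y' X_k Ṽ_k X_k' y`. -/
def postSS (τ l : ℝ) (y : Fin n → ℝ) : ℝ :=
  l + y ⬝ᵥ y - ((design X k)ᵀ *ᵥ y) ⬝ᵥ (postScale X k τ *ᵥ ((design X k)ᵀ *ᵥ y))

/-- The expectation of the MOM penalty when `θ_k | φ ∼ N(θ̃_k, φ Ṽ_k)` and
`φ ∼ IG((a + n) / 2, s̃_k / 2)`. -/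
def postPenalty (τ a l : ℝ) (y : Fin n → ℝ) : ℝ :=
  ∫ φ in Set.Ioi (0 : ℝ), ∫ θ : k → ℝ,
    normalPDF (postMean X k τ y) (φ • postScale X k τ) θ *
      invGammaPDF ((a + n) / 2) (postSS X k τ l y / 2) φ * penalty X k τ φ θ

/-- The eigenvalues `ρ_{k1}, …, ρ_{kp_k}` of `V_k X_k' X_k`, with multiplicity. -/
def eigs : Multiset ℝ := (priorScale X k * gram X k).charpoly.roots

/-- The smallest eigenvalue `ρ_{kp_k}` of `V_k X_k' X_k`, for a nonempty model. -/
def minEig : ℝ := sInf {ρ | ρ ∈ eigs X k}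

/-- `∏_j (τ ρ_{kj} + 1)^{1/2}`. -/
def eigProd (τ : ℝ) : ℝ := ((eigs X k).map fun ρ => (τ * ρ + 1) ^ (1 / 2 : ℝ)).prod

/-- `D_{kl}`, the ratio of the posterior expected MOM penalties of the models `k` and `l`. -/
def penaltyRatio (k l : Finset (Fin p)) (τ a lφ : ℝ) (y : Fin n → ℝ) : ℝ :=
  postPenalty X k τ a lφ y / postPenalty X l τ a lφ y

end Model

/-- The law `N(μ, φ I)` on `ℝⁿ`. -/
def truth {n : ℕ} (μ : Fin n → ℝ) (φ : ℝ) : Measure (Fin n → ℝ) :=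
  Measure.pi fun i => gaussianReal (μ i) φ.toNNReal

/-- The data of a variable selection problem with sample size `n`. -/
structure Problem (n : ℕ) where
  /-- number of available variables -/
  p : ℕ
  /-- the design matrix -/
  X : Matrix (Fin n) (Fin p) ℝ
  /-- the candidate models, as sets of columns -/
  models : Finset (Finset (Fin p))
  /-- prior model probabilities -/
  prior : Finset (Fin p) → ℝ
  /-- prior dispersion -/
  τ : ℝ
  /-- the data-generating model -/
  t : Finset (Fin p)
  /-- the data-generating regression coefficients -/
  θstar : t → ℝ
  /-- the data-generating error variance -/
  φstar : ℝ
  /-- the model under study -/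
  m : Finset (Fin p)

namespace Problem

variable {n : ℕ} (P : Problem n)

/-- The standing assumptions; the last three fields say that `m` is a spurious model,
i.e. a candidate which strictly contains `t`. -/
structure IsAdmissible : Prop where
  tau_pos : 0 < P.τ
  phi_pos : 0 < P.φstar
  prior_pos : ∀ k ∈ P.models, 0 < P.prior k
  prior_sum : ∑ k ∈ P.models, P.prior k = 1
  prior_size : ∀ k ∈ P.models, ∀ l ∈ P.models, k.card = l.card → P.prior k = P.prior l
  gram_isUnit : ∀ k ∈ P.models, IsUnit (gram P.X k)
  t_nonempty : P.t.Nonempty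
  t_mem : P.t ∈ P.models
  m_mem : P.m ∈ P.models
  t_ssubset_m : P.t ⊂ P.m

/-- The maximum model size. -/
def pbar : ℕ := P.models.sup Finset.card

/-- The prior odds `r_{p_m,p_t} = p(M_m) / p(M_t)`. -/
def r : ℝ := P.prior P.m / P.prior P.t

/-- `p_m - p_t`, as a real number. -/
def excess : ℝ := (P.m.card : ℝ) - (P.t.card : ℝ)

/-- The mean `X_t θ_t*` of the data. -/
def mean : Fin n → ℝ := design P.X P.t *ᵥ P.θstar

/-- The data-generating law `N(X_t θ_t*, φ* I)`. -/
def law : Measure (Fin n → ℝ) := truth P.mean P.φstar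

/-- The non-centrality parameter `λ_{t0} = (X_t θ_t*)'(X_t θ_t*) / φ*`. -/
def noncentrality : ℝ := P.mean ⬝ᵥ P.mean / P.φstar

end Problem

end MomSelection

end

/-!
The normal factor of the prior is that of ridge regression, so the marginal likelihood of `M_k` is
explicit: up to a factor common to all models it is the posterior expected MOM penalty times
`s̃_k^(-(a+n)/2) / ∏_j (τ ρ_kj + 1)^(1/2)`. The posterior odds of `M_m` against `M_t` are therefore
`r D_mt (s̃_t / s̃_m)^((a+n)/2)` divided by a ratio of determinants of order `τ^((p_m-p_t)/2)`.
Off the event `D_mt > h^(-(p_m-p_t))` the posterior probability `min 1 odds ≤ odds^α'` is bounded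
by a deterministic power times `(s̃_t / s̃_m)^(α'(a+n)/2)`, and it remains to bound the expectation
of the latter.

Dropping the columns of `M_m` that are not in `M_t` raises the minimum of the ridge loss by a
quadratic form in the data supported on a space `U` of dimension at most `p_m - p_t`, and bounded
by the squared norm. The minimum itself dominates the squared projection of the noise on
`K = ker X_m'`, which is orthogonal to `U` and of dimension at least `n - p_m`. So
`s̃_t / s̃_m ≤ 1 + (c |P_U z|² + η) / |P_K z|²`, with `P_U z` and `P_K z` independent standard
Gaussian vectors and `η` of the order of `λ_t0 / (τ ρ_tp_t)`. Integrating out `P_K z` leaves an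
exponential moment of `|P_U z|²`, which is at most `C^(p_m-p_t)`; taking `α' > α` leaves a spare
negative power of `h` to absorb this geometric factor.
-/

noncomputable section

namespace MomSelection

section Gaussian

open Set Module
open scoped ENNReal RealInnerProductSpace

lemma lintegral_fun_norm_addHaar {E : Type*} [NormedAddCommGroup E] [NormedSpace ℝ E]
    [FiniteDimensional ℝ E] [Nontrivial E] [MeasurableSpace E] [BorelSpace E]
    (μ : Measure E) [μ.IsAddHaarMeasure] {f : ℝ → ℝ≥0∞} (hf : Measurable f) :
    ∫⁻ x, f ‖x‖ ∂μ =
      μ.toSphere univ * ∫⁻ s in Ioi (0 : ℝ), ENNReal.ofReal (s ^ (finrank ℝ E - 1)) * f s := by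
  calc ∫⁻ x, f ‖x‖ ∂μ
      = ∫⁻ x : ({(0)}ᶜ : Set E), f ‖x.1‖ ∂(μ.comap Subtype.val) := by
        rw [lintegral_subtype_comap (measurableSet_singleton _).compl fun x : E => f ‖x‖,
          restrict_compl_singleton]
    _ = ∫⁻ x, f x.2 ∂μ.toSphere.prod (.volumeIoiPow (finrank ℝ E - 1)) := by
        rw [← μ.measurePreserving_homeomorphUnitSphereProd.lintegral_comp
          (f := fun x => f x.2) (by fun_prop)]
        simp only [homeomorphUnitSphereProd_apply_snd_coe]
    _ = μ.toSphere univ * ∫⁻ s : Ioi (0 : ℝ), f s ∂.volumeIoiPow (finrank ℝ E - 1) := by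
        rw [lintegral_prod _ (by fun_prop)]
        simp only [lintegral_const]
        rw [mul_comm]
    _ = _ := by
        rw [Measure.volumeIoiPow, lintegral_withDensity_eq_lintegral_mul _ (by fun_prop)
          (by fun_prop), ← lintegral_subtype_comap measurableSet_Ioi]
        rfl

lemma one_add_rpow_le {x γ θ : ℝ} (hx : 0 ≤ x) (hγ : 0 ≤ γ) (hθ : 0 < θ) (hθ1 : θ ≤ 1) :
    (1 + x) ^ γ ≤ (1 + θ * x) ^ (γ / θ) := by
  have bernoulli : 1 + x ≤ (1 + θ * x) ^ (1 / θ) := by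
    simpa [← mul_assoc, hθ.ne'] using one_add_mul_self_le_rpow_one_add (s := θ * x)
      (by linarith [mul_nonneg hθ.le hx]) (p := 1 / θ) ((one_le_div hθ).2 hθ1)
  calc (1 + x) ^ γ ≤ ((1 + θ * x) ^ (1 / θ)) ^ γ := Real.rpow_le_rpow (by positivity) bernoulli hγ
    _ = (1 + θ * x) ^ (γ / θ) := by
        rw [← Real.rpow_mul (by positivity), one_div_mul_eq_div]

lemma one_add_div_rpow_le {u l γ s : ℝ} {e : ℕ} (hu : 0 ≤ u) (hl : 0 ≤ l) (hγ : 0 ≤ γ)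
    (he : 2 * γ ≤ e) (hs : 0 < s) :
    (1 + u / (l + s ^ 2)) ^ γ ≤ (√(s ^ 2 + u) / s) ^ e := by
  have hbase : 1 + u / (l + s ^ 2) ≤ (√(s ^ 2 + u) / s) ^ 2 := by
    rw [div_pow, Real.sq_sqrt (by positivity), add_div, div_self (by positivity)]
    gcongr
    linarith
  have hone : 1 ≤ √(s ^ 2 + u) / s := by
    rw [one_le_div hs]
    exact Real.le_sqrt_of_sq_le (by linarith)
  calc (1 + u / (l + s ^ 2)) ^ γ
      ≤ ((√(s ^ 2 + u) / s) ^ 2) ^ γ := Real.rpow_le_rpow (by positivity) hbase hγ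
    _ = (√(s ^ 2 + u) / s) ^ (2 * γ) := by
        rw [← Real.rpow_natCast, ← Real.rpow_mul (by positivity), Nat.cast_ofNat]
    _ ≤ (√(s ^ 2 + u) / s) ^ (e : ℝ) := Real.rpow_le_rpow_of_exponent_le hone he
    _ = (√(s ^ 2 + u) / s) ^ e := Real.rpow_natCast _ _

lemma radial_integrand_le {d : ℕ} {u l γ s : ℝ} (hu : 0 ≤ u) (hl : 0 ≤ l) (hγ : 0 ≤ γ)
    (hd : 2 * γ + 2 ≤ d) (hs : 0 < s) :
    s ^ (d - 1) * (Real.exp (-(1 / 2) * s ^ 2) * (1 + u / (l + s ^ 2)) ^ γ) ≤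
      Real.exp (u / 2) * (s / √(s ^ 2 + u) *
        (√(s ^ 2 + u) ^ (d - 1) * Real.exp (-(1 / 2) * √(s ^ 2 + u) ^ 2))) := by
  obtain ⟨e, rfl⟩ : ∃ e, d = 2 + e :=
    Nat.exists_eq_add_of_le (by exact_mod_cast (by linarith : (2 : ℝ) ≤ d))
  have hle := one_add_div_rpow_le (e := e) hu hl hγ (by push_cast at hd; linarith) hs
  have ht : 0 < √(s ^ 2 + u) := Real.sqrt_pos.2 (by positivity)
  have hexp : Real.exp (-(1 / 2) * s ^ 2) =
      Real.exp (u / 2) * Real.exp (-(1 / 2) * √(s ^ 2 + u) ^ 2) := by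
    rw [Real.sq_sqrt (by positivity), ← Real.exp_add]
    ring_nf
  generalize √(s ^ 2 + u) = t at hle ht hexp ⊢
  rw [show 2 + e - 1 = e + 1 by lia, hexp]
  calc _ ≤ s ^ (e + 1) * (Real.exp (u / 2) * Real.exp (-(1 / 2) * t ^ 2) * (t / s) ^ e) := by
        gcongr
    _ = _ := by
        rw [div_pow]
        field_simp
        ring

/- The substitution `t = √(s² + u)` turns `s ds` into `t dt` and `exp (-s² / 2)` into
`exp (u / 2) exp (-t² / 2)`. -/
lemma lintegral_radial_le {d : ℕ} {u l γ : ℝ} (hu : 0 ≤ u) (hl : 0 ≤ l)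
    (hγ : 0 ≤ γ) (hd : 2 * γ + 2 ≤ d) :
    ∫⁻ s in Ioi (0 : ℝ), ENNReal.ofReal (s ^ (d - 1)) *
        (ENNReal.ofReal (Real.exp (-(1 / 2) * s ^ 2)) *
          ENNReal.ofReal ((1 + u / (l + s ^ 2)) ^ γ)) ≤
      ENNReal.ofReal (Real.exp (u / 2)) * ∫⁻ s in Ioi (0 : ℝ), ENNReal.ofReal (s ^ (d - 1)) *
        ENNReal.ofReal (Real.exp (-(1 / 2) * s ^ 2)) := by
  let F : ℝ → ℝ≥0∞ := fun s =>
    ENNReal.ofReal (s ^ (d - 1)) * ENNReal.ofReal (Real.exp (-(1 / 2) * s ^ 2))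
  have hderiv (s : ℝ) (hs : 0 < s) :
      HasDerivWithinAt (fun s => √(s ^ 2 + u)) (s / √(s ^ 2 + u)) (Ioi 0) s := by
    refine (((hasDerivAt_pow 2 s).add_const u).sqrt (by positivity)).hasDerivWithinAt.congr_deriv ?_
    field_simp
    norm_num
  have hsubst := lintegral_image_eq_lintegral_deriv_mul_of_monotoneOn measurableSet_Ioi hderiv
    (fun s (hs : 0 < s) t _ hst => Real.sqrt_le_sqrt (by gcongr)) F
  have himage : (fun s : ℝ => √(s ^ 2 + u)) '' Ioi 0 ⊆ Ioi 0 := by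
    rintro _ ⟨s, hs : 0 < s, rfl⟩
    exact Real.sqrt_pos.2 (by positivity)
  calc _ ≤ ∫⁻ s in Ioi (0 : ℝ), ENNReal.ofReal (Real.exp (u / 2)) *
        (ENNReal.ofReal (s / √(s ^ 2 + u)) * F √(s ^ 2 + u)) := by
        refine setLIntegral_mono' measurableSet_Ioi fun s (hs : 0 < s) => ?_
        simp only [F]
        repeat rw [← ENNReal.ofReal_mul (by positivity)]
        exact ENNReal.ofReal_le_ofReal (radial_integrand_le hu hl hγ hd hs)
    _ = ENNReal.ofReal (Real.exp (u / 2)) *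
        ∫⁻ s in (fun s : ℝ => √(s ^ 2 + u)) '' Ioi 0, F s := by
        rw [lintegral_const_mul' _ _ ENNReal.ofReal_ne_top, hsubst]
    _ ≤ ENNReal.ofReal (Real.exp (u / 2)) * ∫⁻ s in Ioi 0, F s := by
        gcongr

variable {E : Type*} [NormedAddCommGroup E] [InnerProductSpace ℝ E]

variable (E) in
/-- The constant `(2π)^{-d/2}` of the standard normal density on a space of dimension `d`. -/
def stdConst : ℝ := ((2 * Real.pi) ^ (finrank ℝ E / 2 : ℝ))⁻¹

variable (E) in
lemma stdConst_pos : 0 < stdConst E := by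
  unfold stdConst
  positivity

variable [FiniteDimensional ℝ E] [MeasurableSpace E] [BorelSpace E]

lemma integrable_exp_neg_mul_sq_norm {b : ℝ} (hb : 0 < b) :
    Integrable (fun v : E => Real.exp (-b * ‖v‖ ^ 2)) := by
  refine (GaussianFourier.integrable_cexp_neg_mul_sq_norm_add
    (b := (b : ℂ)) (by simpa using hb) 0 (0 : E)).norm.congr (ae_of_all _ fun v => ?_)
  simp only [Complex.norm_exp]
  simp [← Complex.ofReal_pow]

lemma lintegral_exp_neg_mul_sq_norm {b : ℝ} (hb : 0 < b) :
    ∫⁻ v : E, ENNReal.ofReal (stdConst E * Real.exp (-(b / 2) * ‖v‖ ^ 2)) =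
      ENNReal.ofReal (b ^ (-(finrank ℝ E / 2 : ℝ))) := by
  rw [← ofReal_integral_eq_lintegral_ofReal
    ((integrable_exp_neg_mul_sq_norm (by positivity)).const_mul _)
    (ae_of_all _ fun v => mul_nonneg (stdConst_pos E).le (Real.exp_pos _).le),
    integral_const_mul, GaussianFourier.integral_rexp_neg_mul_sq_norm (by positivity),
    stdConst, show Real.pi / (b / 2) = (2 * Real.pi) * b⁻¹ by field_simp,
    Real.mul_rpow (x := 2 * Real.pi) (by positivity) (by positivity),
    inv_mul_cancel_left₀ (by positivity),
    Real.inv_rpow hb.le, Real.rpow_neg hb.le]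

lemma integral_stdConst_mul_cexp (t : E) :
    ∫ v : E, (stdConst E : ℂ) * Complex.exp (-(1 / 2) * ‖v‖ ^ 2 + Complex.I * ⟪t, v⟫) =
      Complex.exp (-‖t‖ ^ 2 / 2) := by
  have hconst : (Real.pi / (1 / 2) : ℂ) ^ (finrank ℝ E / 2 : ℂ) =
      (((2 * Real.pi) ^ (finrank ℝ E / 2 : ℝ) : ℝ) : ℂ) := by
    rw [Complex.ofReal_cpow (by positivity)]
    push_cast
    ring_nf
  rw [integral_const_mul,
    GaussianFourier.integral_cexp_neg_mul_sq_norm_add (by norm_num) Complex.I t, hconst,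
    ← mul_assoc, ← Complex.ofReal_mul, stdConst, inv_mul_cancel₀ (by positivity)]
  simp only [Complex.I_sq, Complex.ofReal_one, one_mul]
  ring_nf

variable (E) in
lemma stdGaussian_eq_withDensity :
    stdGaussian E = volume.withDensity fun v : E =>
      ENNReal.ofReal (stdConst E * Real.exp (-(1 / 2) * ‖v‖ ^ 2)) := by
  have : IsFiniteMeasure (volume.withDensity fun v : E =>
      ENNReal.ofReal (stdConst E * Real.exp (-(1 / 2) * ‖v‖ ^ 2))) := by
    refine isFiniteMeasure_withDensity ?_
    rw [lintegral_exp_neg_mul_sq_norm one_pos]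
    exact ENNReal.ofReal_ne_top
  refine Measure.ext_of_charFun (funext fun t => ?_)
  rw [charFun_stdGaussian, charFun_apply,
    integral_withDensity_eq_integral_toReal_smul (by fun_prop) (ae_of_all _ fun _ => by simp),
    ← integral_stdConst_mul_cexp]
  refine (integral_congr_ae (ae_of_all _ fun v => ?_)).symm
  simp only [ENNReal.toReal_ofReal (mul_nonneg (stdConst_pos E).le (Real.exp_pos _).le),
    Complex.exp_add, real_inner_comm v t]
  simp [Complex.real_smul, mul_assoc, mul_comm Complex.I]

lemma lintegral_stdGaussian {f : E → ℝ≥0∞} (hf : Measurable f) :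
    ∫⁻ v, f v ∂stdGaussian E =
      ∫⁻ v, ENNReal.ofReal (stdConst E * Real.exp (-(1 / 2) * ‖v‖ ^ 2)) * f v := by
  rw [stdGaussian_eq_withDensity, lintegral_withDensity_eq_lintegral_mul _ (by fun_prop) hf]
  rfl

lemma lintegral_fun_norm_stdGaussian [Nontrivial E] {f : ℝ → ℝ≥0∞} (hf : Measurable f) :
    ∫⁻ v, f ‖v‖ ∂stdGaussian E =
      ENNReal.ofReal (stdConst E) * (volume : Measure E).toSphere univ *
        ∫⁻ s in Ioi (0 : ℝ), ENNReal.ofReal (s ^ (finrank ℝ E - 1)) *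
          (ENNReal.ofReal (Real.exp (-(1 / 2) * s ^ 2)) * f s) := by
  rw [lintegral_stdGaussian (by fun_prop), mul_assoc,
    ← lintegral_fun_norm_addHaar volume
      (f := fun s => ENNReal.ofReal (Real.exp (-(1 / 2) * s ^ 2)) * f s) (by fun_prop),
    ← lintegral_const_mul' _ _ ENNReal.ofReal_ne_top]
  simp_rw [ENNReal.ofReal_mul (stdConst_pos E).le, mul_assoc]

lemma lintegral_exp_sq_norm_stdGaussian {c : ℝ} (hc : c < 1) :
    ∫⁻ v, ENNReal.ofReal (Real.exp (c / 2 * ‖v‖ ^ 2)) ∂stdGaussian E =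
      ENNReal.ofReal ((1 - c) ^ (-(finrank ℝ E / 2 : ℝ))) := by
  rw [lintegral_stdGaussian (by fun_prop), ← lintegral_exp_neg_mul_sq_norm (sub_pos.2 hc)]
  refine lintegral_congr fun v => ?_
  rw [← ENNReal.ofReal_mul (mul_nonneg (stdConst_pos E).le (Real.exp_pos _).le), mul_assoc,
    ← Real.exp_add]
  ring_nf

lemma lintegral_one_add_div_rpow_stdGaussian_le {u l γ : ℝ} (hu : 0 ≤ u) (hl : 0 ≤ l)
    (hγ : 0 ≤ γ) (hd : 2 * γ + 2 ≤ finrank ℝ E) :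
    ∫⁻ v, ENNReal.ofReal ((1 + u / (l + ‖v‖ ^ 2)) ^ γ) ∂stdGaussian E ≤
      ENNReal.ofReal (Real.exp (u / 2)) := by
  have : Nontrivial E :=
    nontrivial_of_finrank_pos (R := ℝ) (by exact_mod_cast (by linarith : (0 : ℝ) < finrank ℝ E))
  have hmass := lintegral_fun_norm_stdGaussian (E := E) (f := 1) measurable_one
  simp only [Pi.one_apply, lintegral_one, measure_univ, mul_one] at hmass
  rw [lintegral_fun_norm_stdGaussian
    (f := fun s => ENNReal.ofReal ((1 + u / (l + s ^ 2)) ^ γ)) (by fun_prop)]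
  grw [lintegral_radial_le hu hl hγ hd]
  rw [mul_left_comm, ← hmass, mul_one]

lemma map_orthogonalProjectionOnto_prod_stdGaussian {K U : Submodule ℝ E} (hKU : K ⟂ U) :
    (stdGaussian E).map (fun v => (K.orthogonalProjectionOnto v, U.orthogonalProjectionOnto v)) =
      (stdGaussian K).prod (stdGaussian U) := by
  have hmeas : Measurable fun v : E =>
      (K.orthogonalProjectionOnto v, U.orthogonalProjectionOnto v) := by
    fun_prop
  have := Measure.isProbabilityMeasure_map (μ := stdGaussian E) hmeas.aemeasurable
  refine charFun_eq_prod_iff.1 fun t => ?_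
  have hinner (v : E) : ⟪WithLp.toLp 2 (K.orthogonalProjectionOnto v,
      U.orthogonalProjectionOnto v), t⟫ = ⟪v, ((t.ofLp.1 : E) + t.ofLp.2)⟫ := by
    rw [WithLp.prod_inner_apply, inner_add_right]
    simp
  have hnorm : ‖(t.ofLp.1 : E) + t.ofLp.2‖ ^ 2 = ‖t.ofLp.1‖ ^ 2 + ‖t.ofLp.2‖ ^ 2 := by
    rw [norm_add_sq_real, hKU.inner_eq t.ofLp.1.2 t.ofLp.2.2]
    simp
  rw [charFun_apply, integral_map (by fun_prop) (by fun_prop),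
    integral_map (by fun_prop) (by fun_prop)]
  simp_rw [hinner]
  rw [← charFun_apply, charFun_stdGaussian, charFun_stdGaussian, charFun_stdGaussian,
    ← Complex.exp_add, ← Complex.ofReal_pow, hnorm]
  push_cast
  ring_nf

/- Bernoulli's inequality trades the factor `1` of the numerator for `θ < 1`, which makes the
exponential moment of the projection to `U` finite. -/
lemma lintegral_rpow_projection_ratio_le {K U : Submodule ℝ E} (hKU : K ⟂ U)
    {l γ θ c η : ℝ} (hl : 0 ≤ l) (hγ : 0 ≤ γ) (hθ : 0 < θ) (hθ1 : θ ≤ 1) (hc : 0 ≤ c)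
    (hη : 0 ≤ η) (hcθ : θ * c < 1) (hd : 2 * (γ / θ) + 2 ≤ finrank ℝ K) :
    ∫⁻ v, ENNReal.ofReal ((1 + (c * ‖U.orthogonalProjectionOnto v‖ ^ 2 + η) /
        (l + ‖K.orthogonalProjectionOnto v‖ ^ 2)) ^ γ) ∂stdGaussian E ≤
      ENNReal.ofReal (Real.exp (θ * η / 2) * (1 - θ * c) ^ (-(finrank ℝ U / 2 : ℝ))) := by
  have hindep : ∫⁻ v, ENNReal.ofReal ((1 + (c * ‖U.orthogonalProjectionOnto v‖ ^ 2 + η) /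
        (l + ‖K.orthogonalProjectionOnto v‖ ^ 2)) ^ γ) ∂stdGaussian E =
      ∫⁻ w, ∫⁻ v, ENNReal.ofReal ((1 + (c * ‖w‖ ^ 2 + η) /
        (l + ‖v‖ ^ 2)) ^ γ) ∂stdGaussian K ∂stdGaussian U := by
    rw [← lintegral_prod_symm' (fun w : K × U => ENNReal.ofReal ((1 + (c * ‖w.2‖ ^ 2 + η) /
        (l + ‖w.1‖ ^ 2)) ^ γ)) (by fun_prop), ← map_orthogonalProjectionOnto_prod_stdGaussian hKU,
      lintegral_map (by fun_prop) (by fun_prop)]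
  have hinner (w : U) : ∫⁻ v, ENNReal.ofReal ((1 + (c * ‖w‖ ^ 2 + η) / (l + ‖v‖ ^ 2)) ^ γ)
        ∂stdGaussian K ≤ ENNReal.ofReal (Real.exp (θ * (c * ‖w‖ ^ 2 + η) / 2)) := by
    refine (lintegral_mono fun v => ENNReal.ofReal_le_ofReal ?_).trans
      (lintegral_one_add_div_rpow_stdGaussian_le (u := θ * (c * ‖w‖ ^ 2 + η))
        (by positivity) hl (by positivity) hd)
    rw [mul_div_assoc]
    exact one_add_rpow_le (by positivity) hγ hθ hθ1
  rw [hindep]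
  refine (lintegral_mono hinner).trans_eq ?_
  rw [ENNReal.ofReal_mul (Real.exp_pos _).le, ← lintegral_exp_sq_norm_stdGaussian hcθ,
    ← lintegral_const_mul' _ _ ENNReal.ofReal_ne_top]
  refine lintegral_congr fun w => ?_
  rw [← ENNReal.ofReal_mul (Real.exp_pos _).le, ← Real.exp_add]
  ring_nf

end Gaussian

section QuadraticForm

variable {ι : Type*} [Fintype ι]

lemma dotProduct_ofLp_self (v : EuclideanSpace ℝ ι) : v.ofLp ⬝ᵥ v.ofLp = ‖v‖ ^ 2 := by
  rw [EuclideanSpace.real_norm_sq_eq]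
  simp only [dotProduct, sq]

lemma dotProduct_mulVec_comm {R : Matrix ι ι ℝ} (hR : R.IsHermitian) (x y : ι → ℝ) :
    x ⬝ᵥ (R *ᵥ y) = y ⬝ᵥ (R *ᵥ x) := by
  have hT : Rᵀ = R := by simpa only [Matrix.conjTranspose_eq_transpose_of_trivial] using hR.eq
  rw [Matrix.dotProduct_mulVec, ← Matrix.mulVec_transpose, hT, dotProduct_comm]

lemma dotProduct_diagonal_mulVec [DecidableEq ι] (d θ : ι → ℝ) :
    θ ⬝ᵥ (Matrix.diagonal d *ᵥ θ) = ∑ j, d j * θ j ^ 2 := by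
  simp only [dotProduct, Matrix.mulVec_diagonal]
  exact Finset.sum_congr rfl fun j _ => by ring

lemma dotProduct_transpose_mul_self_mulVec {κ : Type*} [Fintype κ] (A : Matrix ι κ ℝ)
    (θ : κ → ℝ) : θ ⬝ᵥ ((Aᵀ * A) *ᵥ θ) = (A *ᵥ θ) ⬝ᵥ (A *ᵥ θ) := by
  rw [← Matrix.mulVec_mulVec, Matrix.dotProduct_mulVec, Matrix.vecMul_transpose]

lemma quadratic_form_add_le {R : Matrix ι ι ℝ} (hR : R.PosSemidef) {δ : ℝ} (hδ : 0 < δ)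
    (u v : ι → ℝ) :
    (u + v) ⬝ᵥ (R *ᵥ (u + v)) ≤ (1 + δ) * (v ⬝ᵥ (R *ᵥ v)) + (1 + 1 / δ) * (u ⬝ᵥ (R *ᵥ u)) := by
  have hcross : 0 ≤ (δ • v - u) ⬝ᵥ (R *ᵥ (δ • v - u)) := hR.dotProduct_mulVec_nonneg _
  have hcomm := dotProduct_mulVec_comm hR.isHermitian u v
  simp only [Matrix.mulVec_sub, Matrix.mulVec_add, Matrix.mulVec_smul, sub_dotProduct,
    add_dotProduct, dotProduct_sub, dotProduct_add, smul_dotProduct, dotProduct_smul,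
    smul_eq_mul, hcomm] at hcross ⊢
  have hsq : 2 * (v ⬝ᵥ (R *ᵥ u)) ≤ δ * (v ⬝ᵥ (R *ᵥ v)) + 1 / δ * (u ⬝ᵥ (R *ᵥ u)) := by
    rw [← mul_le_mul_iff_right₀ hδ]
    field_simp
    linarith
  linarith

lemma quadratic_form_le_norm_sq_projection [DecidableEq ι] {R : Matrix ι ι ℝ}
    (hR : R.IsHermitian) (hle : ∀ x, x ⬝ᵥ (R *ᵥ x) ≤ x ⬝ᵥ x) (v : EuclideanSpace ℝ ι) :
    v.ofLp ⬝ᵥ (R *ᵥ v.ofLp) ≤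
      ‖(LinearMap.ker (Matrix.toEuclideanLin R))ᗮ.orthogonalProjectionOnto v‖ ^ 2 := by
  set N := LinearMap.ker (Matrix.toEuclideanLin R)
  obtain ⟨u, hu⟩ : ∃ u : Nᗮ, Nᗮ.orthogonalProjectionOnto v = u := ⟨_, rfl⟩
  have hker : R *ᵥ (v - u).ofLp = 0 := by
    have hmem : v - u ∈ N := by
      have hproj := Submodule.sub_starProjection_mem_orthogonal (K := Submodule.orthogonal N) v
      rwa [Submodule.orthogonal_orthogonal, Submodule.starProjection_apply, hu] at hproj
    exact congrArg WithLp.ofLp hmem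
  have hsplit : v.ofLp = u.1.ofLp + (v - u).ofLp := by simp
  calc v.ofLp ⬝ᵥ (R *ᵥ v.ofLp) = u.1.ofLp ⬝ᵥ (R *ᵥ u.1.ofLp) := by
        rw [hsplit, Matrix.mulVec_add, hker, add_zero, add_dotProduct,
          dotProduct_mulVec_comm hR (v - u).ofLp, hker, dotProduct_zero, add_zero]
    _ ≤ u.1.ofLp ⬝ᵥ u.1.ofLp := hle _
    _ = ‖Nᗮ.orthogonalProjectionOnto v‖ ^ 2 := by rw [dotProduct_ofLp_self, hu]; rfl

end QuadraticForm

section Ridge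

open Module

variable {ι κ κ' : Type*} {A : Matrix ι κ ℝ} {w : κ → ℝ}

section Precision

variable [Fintype ι] [DecidableEq κ]

/-- The matrix `A'A + diag w` of the normal equations of ridge regression. -/
def ridgePrecision (A : Matrix ι κ ℝ) (w : κ → ℝ) : Matrix κ κ ℝ :=
  Aᵀ * A + Matrix.diagonal w

lemma ridgePrecision_posDef [Finite κ] (hw : ∀ j, 0 < w j) : (ridgePrecision A w).PosDef := by
  have hgram := Matrix.posSemidef_conjTranspose_mul_self A
  rw [Matrix.conjTranspose_eq_transpose_of_trivial] at hgram
  exact Matrix.PosDef.posSemidef_add hgram (Matrix.PosDef.diagonal hw)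

end Precision

variable [Fintype κ] [Fintype κ']

lemma sum_extend_zero (e : κ' ↪ κ) (θ : κ' → ℝ) {f : κ → ℝ → ℝ} (hf : ∀ j, f j 0 = 0) :
    ∑ j, f j (Function.extend e θ 0 j) = ∑ j, f (e j) (θ j) := by
  refine (Fintype.sum_of_injective e e.injective _ _ (fun j hj => ?_) fun j => ?_).symm
  · rw [Function.extend_apply' _ _ _ (by simpa using hj), Pi.zero_apply, hf]
  · rw [e.injective.extend_apply]

lemma mulVec_extend (e : κ' ↪ κ) (θ : κ' → ℝ) :
    A *ᵥ Function.extend e θ 0 = A.submatrix id e *ᵥ θ :=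
  funext fun i => sum_extend_zero e θ (f := fun j x => A i j * x) (by simp)

variable [Fintype ι]

/-- The penalised residual sum of squares `|y - A θ|² + ∑ⱼ wⱼ θⱼ²` of ridge regression. -/
def ridgeLoss (A : Matrix ι κ ℝ) (w : κ → ℝ) (y : ι → ℝ) (θ : κ → ℝ) : ℝ :=
  (y - A *ᵥ θ) ⬝ᵥ (y - A *ᵥ θ) + ∑ j, w j * θ j ^ 2

lemma ridgeLoss_nonneg (hw : ∀ j, 0 ≤ w j) (y : ι → ℝ) (θ : κ → ℝ) : 0 ≤ ridgeLoss A w y θ :=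
  add_nonneg (Finset.sum_nonneg fun _ _ => mul_self_nonneg _)
    (Finset.sum_nonneg fun j _ => mul_nonneg (hw j) (sq_nonneg _))

lemma ridgeLoss_extend (e : κ' ↪ κ) (y : ι → ℝ) (θ : κ' → ℝ) :
    ridgeLoss A w y (Function.extend e θ 0) = ridgeLoss (A.submatrix id e) (w ∘ e) y θ := by
  rw [ridgeLoss, ridgeLoss, mulVec_extend,
    sum_extend_zero e θ (f := fun j x => w j * x ^ 2) (by simp)]
  rfl

lemma card_le_finrank_ker_transpose_add [DecidableEq ι] (A : Matrix ι κ ℝ) :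
    Fintype.card ι ≤ finrank ℝ (LinearMap.ker (Matrix.toEuclideanLin Aᵀ)) + Fintype.card κ := by
  have hker := (Matrix.toEuclideanLin Aᵀ).finrank_range_add_finrank_ker
  have hrange := (LinearMap.range (Matrix.toEuclideanLin Aᵀ)).finrank_le
  rw [finrank_euclideanSpace] at hker hrange
  linarith

variable [DecidableEq κ]

/-- The ridge regression estimator, which minimises `ridgeLoss A w y`. -/
def ridgeEstimator (A : Matrix ι κ ℝ) (w : κ → ℝ) (y : ι → ℝ) : κ → ℝ :=
  (ridgePrecision A w)⁻¹ *ᵥ (Aᵀ *ᵥ y)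

/-- The matrix `1 - A (A'A + diag w)⁻¹ A'` of the quadratic form which maps the data `y` to the
minimum of `ridgeLoss A w y`. -/
def ridgeResid [DecidableEq ι] (A : Matrix ι κ ℝ) (w : κ → ℝ) : Matrix ι ι ℝ :=
  1 - A * (ridgePrecision A w)⁻¹ * Aᵀ

lemma ridgePrecision_mulVec_ridgeEstimator (hw : ∀ j, 0 < w j) (y : ι → ℝ) :
    ridgePrecision A w *ᵥ ridgeEstimator A w y = Aᵀ *ᵥ y := by
  rw [ridgeEstimator, Matrix.mulVec_mulVec, Matrix.mul_nonsing_inv _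
    ((Matrix.isUnit_iff_isUnit_det _).1 (ridgePrecision_posDef hw).isUnit), Matrix.one_mulVec]

variable [DecidableEq ι]

lemma dotProduct_ridgeResid_mulVec (y : ι → ℝ) :
    y ⬝ᵥ (ridgeResid A w *ᵥ y) = y ⬝ᵥ y - (Aᵀ *ᵥ y) ⬝ᵥ ridgeEstimator A w y := by
  rw [ridgeResid, Matrix.sub_mulVec, dotProduct_sub, Matrix.one_mulVec, Matrix.mul_assoc,
    ← Matrix.mulVec_mulVec, Matrix.dotProduct_mulVec, ← Matrix.mulVec_transpose,
    ← Matrix.mulVec_mulVec, ridgeEstimator]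

lemma ridgeResid_isHermitian (hw : ∀ j, 0 < w j) : (ridgeResid A w).IsHermitian := by
  refine Matrix.isHermitian_one.sub ?_
  simpa only [Matrix.conjTranspose_eq_transpose_of_trivial] using
    Matrix.isHermitian_mul_mul_conjTranspose A (ridgePrecision_posDef (A := A) hw).inv.isHermitian

lemma ridgeLoss_eq (hw : ∀ j, 0 < w j) (y : ι → ℝ) (θ : κ → ℝ) :
    ridgeLoss A w y θ = y ⬝ᵥ (ridgeResid A w *ᵥ y) +
      (θ - ridgeEstimator A w y) ⬝ᵥ (ridgePrecision A w *ᵥ (θ - ridgeEstimator A w y)) := by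
  have hest := ridgePrecision_mulVec_ridgeEstimator (A := A) hw y
  have hcomm := dotProduct_mulVec_comm (ridgePrecision_posDef (A := A) hw).isHermitian
    (ridgeEstimator A w y) θ
  have hform : θ ⬝ᵥ (ridgePrecision A w *ᵥ θ) =
      (A *ᵥ θ) ⬝ᵥ (A *ᵥ θ) + ∑ j, w j * θ j ^ 2 := by
    rw [ridgePrecision, Matrix.add_mulVec, dotProduct_add, dotProduct_transpose_mul_self_mulVec,
      dotProduct_diagonal_mulVec]
  have hfit : (A *ᵥ θ) ⬝ᵥ y = θ ⬝ᵥ (Aᵀ *ᵥ y) := by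
    rw [Matrix.dotProduct_mulVec, Matrix.vecMul_transpose]
  simp only [ridgeLoss, Matrix.mulVec_sub, hest, sub_dotProduct, dotProduct_sub, hcomm, hform,
    dotProduct_ridgeResid_mulVec, dotProduct_comm y (A *ᵥ θ), hfit,
    dotProduct_comm (ridgeEstimator A w y)]
  ring

lemma ridgeLoss_ridgeEstimator (hw : ∀ j, 0 < w j) (y : ι → ℝ) :
    ridgeLoss A w y (ridgeEstimator A w y) = y ⬝ᵥ (ridgeResid A w *ᵥ y) := by
  simp [ridgeLoss_eq hw]

lemma ridgeResid_form_le_ridgeLoss (hw : ∀ j, 0 < w j) (y : ι → ℝ) (θ : κ → ℝ) :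
    y ⬝ᵥ (ridgeResid A w *ᵥ y) ≤ ridgeLoss A w y θ := by
  rw [ridgeLoss_eq hw, le_add_iff_nonneg_right]
  exact (ridgePrecision_posDef hw).posSemidef.dotProduct_mulVec_nonneg _

lemma ridgeResid_form_nonneg (hw : ∀ j, 0 < w j) (y : ι → ℝ) :
    0 ≤ y ⬝ᵥ (ridgeResid A w *ᵥ y) := by
  rw [← ridgeLoss_ridgeEstimator hw]
  exact ridgeLoss_nonneg (fun j => (hw j).le) _ _

lemma ridgeResid_form_le_self (hw : ∀ j, 0 < w j) (y : ι → ℝ) :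
    y ⬝ᵥ (ridgeResid A w *ᵥ y) ≤ y ⬝ᵥ y :=
  (ridgeResid_form_le_ridgeLoss hw y 0).trans_eq (by simp [ridgeLoss])

lemma ridgeResid_form_mulVec_le (hw : ∀ j, 0 < w j) (θ : κ → ℝ) :
    (A *ᵥ θ) ⬝ᵥ (ridgeResid A w *ᵥ (A *ᵥ θ)) ≤ ∑ j, w j * θ j ^ 2 :=
  (ridgeResid_form_le_ridgeLoss hw _ θ).trans_eq (by simp [ridgeLoss])

lemma norm_sq_projection_le_ridgeResid_form (hw : ∀ j, 0 < w j) (θ : κ → ℝ)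
    (v : EuclideanSpace ℝ ι) :
    ‖(LinearMap.ker (Matrix.toEuclideanLin Aᵀ)).orthogonalProjectionOnto v‖ ^ 2 ≤
      (A *ᵥ θ + v.ofLp) ⬝ᵥ (ridgeResid A w *ᵥ (A *ᵥ θ + v.ofLp)) := by
  set K := LinearMap.ker (Matrix.toEuclideanLin Aᵀ)
  set y := A *ᵥ θ + v.ofLp
  have hfit (b : κ → ℝ) : K.orthogonalProjectionOnto (WithLp.toLp 2 (A *ᵥ b)) = 0 := by
    rw [Submodule.orthogonalProjectionOnto_eq_zero_iff, Submodule.mem_orthogonal]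
    intro a ha
    have ha' : Aᵀ *ᵥ a.ofLp = 0 := congrArg WithLp.ofLp ha
    rw [EuclideanSpace.inner_eq_star_dotProduct, star_trivial, dotProduct_comm,
      Matrix.dotProduct_mulVec, ← Matrix.mulVec_transpose, ha', zero_dotProduct]
  have hresid : WithLp.toLp 2 (y - A *ᵥ ridgeEstimator A w y) =
      WithLp.toLp 2 (A *ᵥ θ) + v - WithLp.toLp 2 (A *ᵥ ridgeEstimator A w y) := rfl
  calc ‖K.orthogonalProjectionOnto v‖ ^ 2
      = ‖K.orthogonalProjectionOnto (WithLp.toLp 2 (y - A *ᵥ ridgeEstimator A w y))‖ ^ 2 := by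
        rw [hresid, map_sub, map_add, hfit, hfit, zero_add, sub_zero]
    _ ≤ ‖WithLp.toLp 2 (y - A *ᵥ ridgeEstimator A w y)‖ ^ 2 := by
        gcongr
        exact K.norm_orthogonalProjectionOnto_apply_le _
    _ ≤ ridgeLoss A w y (ridgeEstimator A w y) := by
        rw [← dotProduct_ofLp_self, ridgeLoss, le_add_iff_nonneg_right]
        exact Finset.sum_nonneg fun j _ => mul_nonneg (hw j).le (sq_nonneg _)
    _ = y ⬝ᵥ (ridgeResid A w *ᵥ y) := ridgeLoss_ridgeEstimator hw y

section Nested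

variable [DecidableEq κ'] (e : κ' ↪ κ)

variable (A w) in
/-- The matrix of the quadratic form which maps the data to the decrease of the minimum of the
penalised residual sum of squares when the columns outside the range of `e` are added. -/
def ridgeDrop : Matrix ι ι ℝ := ridgeResid (A.submatrix id e) (w ∘ e) - ridgeResid A w

lemma dotProduct_ridgeDrop_mulVec (y : ι → ℝ) :
    y ⬝ᵥ (ridgeDrop A w e *ᵥ y) =
      y ⬝ᵥ (ridgeResid (A.submatrix id e) (w ∘ e) *ᵥ y) - y ⬝ᵥ (ridgeResid A w *ᵥ y) := by
  rw [ridgeDrop, Matrix.sub_mulVec, dotProduct_sub]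

lemma ridgeDrop_posSemidef (hw : ∀ j, 0 < w j) : (ridgeDrop A w e).PosSemidef := by
  refine .of_dotProduct_mulVec_nonneg
    ((ridgeResid_isHermitian fun j => hw (e j)).sub (ridgeResid_isHermitian hw)) fun y => ?_
  rw [star_trivial, dotProduct_ridgeDrop_mulVec, sub_nonneg,
    ← ridgeLoss_ridgeEstimator (w := w ∘ e) fun j => hw (e j), ← ridgeLoss_extend]
  exact ridgeResid_form_le_ridgeLoss hw y _

lemma ridgeDrop_form_le_ridgeResid_form (hw : ∀ j, 0 < w j) (y : ι → ℝ) :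
    y ⬝ᵥ (ridgeDrop A w e *ᵥ y) ≤ y ⬝ᵥ (ridgeResid (A.submatrix id e) (w ∘ e) *ᵥ y) := by
  rw [dotProduct_ridgeDrop_mulVec, sub_le_self_iff]
  exact ridgeResid_form_nonneg hw y

lemma ridgeDrop_mulVec_eq_zero (hw : ∀ j, 0 < w j) {y : ι → ℝ}
    (hy : ∀ j ∉ Set.range e, ridgeEstimator A w y j = 0) : ridgeDrop A w e *ᵥ y = 0 := by
  have hpsd := ridgeDrop_posSemidef (A := A) e hw
  refine (hpsd.dotProduct_mulVec_zero_iff y).1 (le_antisymm ?_ (hpsd.dotProduct_mulVec_nonneg y))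
  have hextend : Function.extend e (ridgeEstimator A w y ∘ e) 0 = ridgeEstimator A w y := by
    funext j
    by_cases hj : j ∈ Set.range e
    · obtain ⟨i, rfl⟩ := hj
      rw [e.injective.extend_apply, Function.comp_apply]
    · rw [Function.extend_apply' _ _ _ (by simpa using hj), hy j hj, Pi.zero_apply]
  rw [star_trivial, dotProduct_ridgeDrop_mulVec, sub_nonpos, ← ridgeLoss_ridgeEstimator hw,
    ← hextend, ridgeLoss_extend]
  exact ridgeResid_form_le_ridgeLoss (fun j => hw (e j)) y _

variable (A w) in
/-- The directions of the data in which adding the columns outside the range of `e` improves the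
ridge fit. -/
def ridgeDropSpace : Submodule ℝ (EuclideanSpace ℝ ι) :=
  (LinearMap.ker (Matrix.toEuclideanLin (ridgeDrop A w e)))ᗮ

lemma ridgeDrop_form_le_norm_sq_projection (hw : ∀ j, 0 < w j) (v : EuclideanSpace ℝ ι) :
    v.ofLp ⬝ᵥ (ridgeDrop A w e *ᵥ v.ofLp) ≤
      ‖(ridgeDropSpace A w e).orthogonalProjectionOnto v‖ ^ 2 :=
  quadratic_form_le_norm_sq_projection (ridgeDrop_posSemidef e hw).isHermitian
    (fun x => (ridgeDrop_form_le_ridgeResid_form e hw x).trans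
      (ridgeResid_form_le_self (fun j => hw (e j)) x)) v

lemma ker_transpose_isOrtho_ridgeDropSpace (hw : ∀ j, 0 < w j) :
    LinearMap.ker (Matrix.toEuclideanLin Aᵀ) ⟂ ridgeDropSpace A w e := by
  refine (Submodule.isOrtho_orthogonal_right _).mono_left fun v hv => ?_
  have hv' : Aᵀ *ᵥ v.ofLp = 0 := congrArg WithLp.ofLp hv
  have hdrop : ridgeDrop A w e *ᵥ v.ofLp = 0 := ridgeDrop_mulVec_eq_zero e hw fun j _ => by
    rw [ridgeEstimator, hv', Matrix.mulVec_zero, Pi.zero_apply]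
  exact congrArg (WithLp.toLp 2) hdrop

lemma finrank_ridgeDropSpace_le (hw : ∀ j, 0 < w j) :
    finrank ℝ (ridgeDropSpace A w e) + Fintype.card κ' ≤ Fintype.card κ := by
  classical
  let coef : EuclideanSpace ℝ ι →ₗ[ℝ] ({j // j ∉ Set.range e} → ℝ) :=
    LinearMap.funLeft ℝ ℝ Subtype.val ∘ₗ (ridgePrecision A w)⁻¹.mulVecLin ∘ₗ
      Aᵀ.mulVecLin ∘ₗ (WithLp.linearEquiv 2 ℝ (ι → ℝ)).toLinearMap
  have hker : LinearMap.ker coef ≤ LinearMap.ker (Matrix.toEuclideanLin (ridgeDrop A w e)) :=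
    fun v hv => congrArg (WithLp.toLp 2)
      (ridgeDrop_mulVec_eq_zero e hw fun j hj => congrFun hv ⟨j, hj⟩)
  have hdrop := (LinearMap.ker (Matrix.toEuclideanLin
    (ridgeDrop A w e))).finrank_add_finrank_orthogonal
  have hcoef := coef.finrank_range_add_finrank_ker
  have hrange := (LinearMap.range coef).finrank_le
  have hmono := Submodule.finrank_mono hker
  rw [finrank_fintype_fun_eq_card, Fintype.card_subtype_compl, Set.card_range_of_injective
    e.injective, Nat.le_sub_iff_add_le (Fintype.card_le_of_embedding e)] at hrange
  unfold ridgeDropSpace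
  linarith

lemma ridgeResid_ratio_le (hw : ∀ j, 0 < w j) {δ l : ℝ} (hδ : 0 < δ) (hl : 0 < l) (θ : κ' → ℝ)
    (v : EuclideanSpace ℝ ι) {y : ι → ℝ} (hy : y = A.submatrix id e *ᵥ θ + v.ofLp) :
    (l + y ⬝ᵥ (ridgeResid (A.submatrix id e) (w ∘ e) *ᵥ y)) /
        (l + y ⬝ᵥ (ridgeResid A w *ᵥ y)) ≤
      1 + ((1 + δ) * ‖(ridgeDropSpace A w e).orthogonalProjectionOnto v‖ ^ 2 +
          (1 + 1 / δ) * ∑ j, w (e j) * θ j ^ 2) /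
        (l + ‖(LinearMap.ker (Matrix.toEuclideanLin Aᵀ)).orthogonalProjectionOnto v‖ ^ 2) := by
  have hpsd := ridgeDrop_posSemidef (A := A) e hw
  have hnum : y ⬝ᵥ (ridgeDrop A w e *ᵥ y) ≤
      (1 + δ) * ‖(ridgeDropSpace A w e).orthogonalProjectionOnto v‖ ^ 2 +
        (1 + 1 / δ) * ∑ j, w (e j) * θ j ^ 2 := by
    grw [hy, quadratic_form_add_le hpsd hδ, ridgeDrop_form_le_norm_sq_projection e hw v,
      ridgeDrop_form_le_ridgeResid_form e hw,
      ridgeResid_form_mulVec_le (w := w ∘ e) fun j => hw (e j)]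
    rfl
  have hden := norm_sq_projection_le_ridgeResid_form (A := A) hw (Function.extend e θ 0) v
  rw [mulVec_extend, ← hy] at hden
  have hpos : 0 < l + y ⬝ᵥ (ridgeResid A w *ᵥ y) :=
    add_pos_of_pos_of_nonneg hl (ridgeResid_form_nonneg hw y)
  calc _ = 1 + y ⬝ᵥ (ridgeDrop A w e *ᵥ y) / (l + y ⬝ᵥ (ridgeResid A w *ᵥ y)) := by
        rw [dotProduct_ridgeDrop_mulVec]
        field_simp
        ring
    _ ≤ _ := by
        gcongr
        exact (hpsd.dotProduct_mulVec_nonneg y).trans hnum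

end Nested

end Ridge

section Pencil

variable {κ : Type*} [Fintype κ] [DecidableEq κ] {d : κ → ℝ} {G : Matrix κ κ ℝ}

lemma det_one_add_smul_eq_prod_roots {K : Type*} [Field K] {M : Matrix κ κ K}
    (hM : M.charpoly.Splits) {τ : K} (hτ : τ ≠ 0) :
    (1 + τ • M).det = (M.charpoly.roots.map fun ρ => τ * ρ + 1).prod := by
  have hmat : 1 + τ • M = (-τ) • (Matrix.scalar κ (-τ⁻¹) - M) := by
    rw [smul_sub, Matrix.scalar_apply, ← Matrix.smul_one_eq_diagonal, smul_smul, neg_mul_neg,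
      mul_inv_cancel₀ hτ, one_smul, neg_smul, sub_neg_eq_add]
  have hcard : Fintype.card κ = M.charpoly.roots.card := by
    rw [← hM.natDegree_eq_card_roots, Matrix.charpoly_natDegree_eq_dim]
  rw [hmat, Matrix.det_smul, ← Matrix.eval_charpoly,
    hM.eval_eq_prod_roots_of_monic M.charpoly_monic, hcard, ← Multiset.prod_replicate,
    ← Multiset.map_const', ← Multiset.prod_map_mul]
  congr 1
  refine Multiset.map_congr rfl fun ρ _ => ?_
  field_simp
  ring

open scoped MatrixOrder in
lemma sub_smul_one_posSemidef_of_forall_le_root {A : Matrix κ κ ℝ} (hA : A.IsHermitian) {c : ℝ}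
    (hc : ∀ ρ ∈ A.charpoly.roots, c ≤ ρ) : (A - c • (1 : Matrix κ κ ℝ)).PosSemidef := by
  rw [← Matrix.le_iff, ← Algebra.algebraMap_eq_smul_one]
  refine algebraMap_le_of_le_spectrum (p := IsSelfAdjoint) ?_ hA
  rw [hA.spectrum_real_eq_range_eigenvalues]
  rintro _ ⟨i, rfl⟩
  refine hc _ ?_
  rw [hA.roots_charpoly_eq_eigenvalues]
  exact Multiset.mem_map_of_mem _ (Finset.mem_univ i)

/-- The matrix `D^{-1/2} G D^{-1/2}` with `D = diag d`, a symmetric matrix similar to `D⁻¹ G`. -/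
def whiten (d : κ → ℝ) (G : Matrix κ κ ℝ) : Matrix κ κ ℝ :=
  (Matrix.diagonal fun j => (√(d j))⁻¹) * G * Matrix.diagonal fun j => (√(d j))⁻¹

lemma inv_diagonal (hd : ∀ j, d j ≠ 0) :
    (Matrix.diagonal d)⁻¹ = Matrix.diagonal fun j => (d j)⁻¹ := by
  refine Matrix.inv_eq_right_inv ?_
  rw [Matrix.diagonal_mul_diagonal, ← Matrix.diagonal_one]
  exact congrArg _ (funext fun j => mul_inv_cancel₀ (hd j))

lemma charpoly_inv_diagonal_mul (hd : ∀ j, 0 < d j) :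
    ((Matrix.diagonal d)⁻¹ * G).charpoly = (whiten d G).charpoly := by
  rw [whiten, Matrix.charpoly_mul_comm (_ * G), ← mul_assoc, Matrix.diagonal_mul_diagonal,
    inv_diagonal fun j => (hd j).ne']
  congr 3
  funext j
  rw [← mul_inv, Real.mul_self_sqrt (hd j).le]

lemma whiten_isHermitian (hG : G.IsHermitian) : (whiten d G).IsHermitian := by
  have hconj := Matrix.isHermitian_mul_mul_conjTranspose
    (Matrix.diagonal fun j => (√(d j))⁻¹) hG
  rwa [Matrix.diagonal_conjTranspose, star_trivial] at hconj

lemma whiten_posDef (hd : ∀ j, 0 < d j) (hG : G.PosDef) : (whiten d G).PosDef := by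
  have hD : IsUnit (Matrix.diagonal fun j => (√(d j))⁻¹) := by
    rw [Matrix.isUnit_diagonal, Pi.isUnit_iff]
    exact fun j => (inv_ne_zero (Real.sqrt_pos.2 (hd j)).ne').isUnit
  have hconj := (Matrix.IsUnit.posDef_star_left_conjugate_iff (x := G) hD).2 hG
  rwa [Matrix.star_eq_conjTranspose, Matrix.diagonal_conjTranspose, star_trivial] at hconj

lemma whiten_form (hd : ∀ j, 0 < d j) (θ : κ → ℝ) :
    (fun j => √(d j) * θ j) ⬝ᵥ (whiten d G *ᵥ fun j => √(d j) * θ j) = θ ⬝ᵥ (G *ᵥ θ) := by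
  have hcancel (j : κ) : (√(d j))⁻¹ * (√(d j) * θ j) = θ j :=
    inv_mul_cancel_left₀ (Real.sqrt_pos.2 (hd j)).ne' _
  have hright : (Matrix.diagonal fun j => (√(d j))⁻¹) *ᵥ (fun j => √(d j) * θ j) = θ :=
    funext fun j => by rw [Matrix.mulVec_diagonal, hcancel]
  have hleft : (fun j => √(d j) * θ j) ᵥ* (Matrix.diagonal fun j => (√(d j))⁻¹) = θ :=
    funext fun j => by rw [Matrix.vecMul_diagonal, mul_comm, hcancel]
  rw [whiten, ← Matrix.mulVec_mulVec, hright, ← Matrix.mulVec_mulVec, Matrix.dotProduct_mulVec,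
    hleft]

lemma splits_charpoly_inv_diagonal_mul (hd : ∀ j, 0 < d j) (hG : G.IsHermitian) :
    ((Matrix.diagonal d)⁻¹ * G).charpoly.Splits := by
  rw [charpoly_inv_diagonal_mul hd]
  exact (whiten_isHermitian hG).splits_charpoly

lemma pos_of_mem_roots_charpoly_inv_diagonal_mul (hd : ∀ j, 0 < d j) (hG : G.PosDef) {ρ : ℝ}
    (hρ : ρ ∈ ((Matrix.diagonal d)⁻¹ * G).charpoly.roots) : 0 < ρ := by
  have hwhite := whiten_posDef hd hG
  rw [charpoly_inv_diagonal_mul hd, hwhite.isHermitian.roots_charpoly_eq_eigenvalues,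
    Multiset.mem_map] at hρ
  obtain ⟨i, -, rfl⟩ := hρ
  exact hwhite.eigenvalues_pos i

lemma mul_sum_le_of_forall_le_root (hd : ∀ j, 0 < d j) (hG : G.IsHermitian) {c : ℝ}
    (hc : ∀ ρ ∈ ((Matrix.diagonal d)⁻¹ * G).charpoly.roots, c ≤ ρ) (θ : κ → ℝ) :
    c * ∑ j, d j * θ j ^ 2 ≤ θ ⬝ᵥ (G *ᵥ θ) := by
  rw [charpoly_inv_diagonal_mul hd] at hc
  have hform := (sub_smul_one_posSemidef_of_forall_le_root (whiten_isHermitian hG)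
    hc).dotProduct_mulVec_nonneg fun j => √(d j) * θ j
  rw [star_trivial, Matrix.sub_mulVec, dotProduct_sub, whiten_form hd, Matrix.smul_mulVec,
    Matrix.one_mulVec, dotProduct_smul, smul_eq_mul, sub_nonneg] at hform
  refine (le_of_eq ?_).trans hform
  congr 1
  refine Finset.sum_congr rfl fun j _ => ?_
  rw [mul_mul_mul_comm, Real.mul_self_sqrt (hd j).le, sq]

end Pencil

section Design

variable {n p : ℕ} {X : Matrix (Fin n) (Fin p) ℝ} {k : Finset (Fin p)}

lemma gram_posDef (hG : IsUnit (gram X k)) : (gram X k).PosDef := by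
  have hgram := Matrix.posSemidef_conjTranspose_mul_self (design X k)
  rw [Matrix.conjTranspose_eq_transpose_of_trivial] at hgram
  exact hgram.posDef_iff_isUnit.2 hG

lemma gram_diag_pos (hG : IsUnit (gram X k)) (j : k) : 0 < gram X k j j :=
  (gram_posDef hG).diag_pos

lemma isUnit_det_diagonal_gram (hG : IsUnit (gram X k)) :
    IsUnit (Matrix.diagonal fun j => gram X k j j).det := by
  rw [Matrix.det_diagonal, isUnit_iff_ne_zero]
  exact Finset.prod_ne_zero_iff.2 fun j _ => (gram_diag_pos hG j).ne'

lemma inv_priorScale (hG : IsUnit (gram X k)) :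
    (priorScale X k)⁻¹ = Matrix.diagonal fun j => gram X k j j :=
  Matrix.nonsing_inv_nonsing_inv _ (isUnit_det_diagonal_gram hG)

variable (X k) in
/-- The weights of the ridge penalty `θ' V_k⁻¹ θ / τ` induced by the normal factor of the prior. -/
def priorWeight (τ : ℝ) (j : k) : ℝ := τ⁻¹ * gram X k j j

lemma priorWeight_pos (hG : IsUnit (gram X k)) {τ : ℝ} (hτ : 0 < τ) (j : k) :
    0 < priorWeight X k τ j :=
  mul_pos (inv_pos.2 hτ) (gram_diag_pos hG j)

lemma postScale_eq (hG : IsUnit (gram X k)) (τ : ℝ) :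
    postScale X k τ = (ridgePrecision (design X k) (priorWeight X k τ))⁻¹ := by
  rw [postScale, inv_priorScale hG, ← Matrix.diagonal_smul]
  rfl

lemma postMean_eq (hG : IsUnit (gram X k)) (τ : ℝ) (y : Fin n → ℝ) :
    postMean X k τ y = ridgeEstimator (design X k) (priorWeight X k τ) y := by
  rw [postMean, postScale_eq hG, ridgeEstimator]

lemma postSS_eq (hG : IsUnit (gram X k)) (τ l : ℝ) (y : Fin n → ℝ) :
    postSS X k τ l y =
      l + y ⬝ᵥ (ridgeResid (design X k) (priorWeight X k τ) *ᵥ y) := by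
  rw [postSS, dotProduct_ridgeResid_mulVec, ← postMean, postMean_eq hG, add_sub_assoc]

lemma postSS_pos (hG : IsUnit (gram X k)) {τ l : ℝ} (hτ : 0 < τ) (hl : 0 < l) (y : Fin n → ℝ) :
    0 < postSS X k τ l y := by
  rw [postSS_eq hG]
  exact add_pos_of_pos_of_nonneg hl (ridgeResid_form_nonneg (priorWeight_pos hG hτ) y)

lemma splits_charpoly_priorScale_mul_gram (hG : IsUnit (gram X k)) :
    (priorScale X k * gram X k).charpoly.Splits :=
  splits_charpoly_inv_diagonal_mul (gram_diag_pos hG) (gram_posDef hG).isHermitian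

lemma pos_of_mem_eigs (hG : IsUnit (gram X k)) {ρ : ℝ} (hρ : ρ ∈ eigs X k) : 0 < ρ :=
  pos_of_mem_roots_charpoly_inv_diagonal_mul (gram_diag_pos hG) (gram_posDef hG) hρ

lemma minEig_le {ρ : ℝ} (hρ : ρ ∈ eigs X k) : minEig X k ≤ ρ :=
  csInf_le (Multiset.finite_toSet _).bddBelow hρ

lemma minEig_pos (hG : IsUnit (gram X k)) (hk : k.Nonempty) : 0 < minEig X k := by
  have hcard : (eigs X k).card = k.card := by
    rw [eigs, ← (splits_charpoly_priorScale_mul_gram hG).natDegree_eq_card_roots,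
      Matrix.charpoly_natDegree_eq_dim, Fintype.card_coe]
  obtain ⟨ρ, hρ⟩ := Multiset.card_pos_iff_exists_mem.1 (hcard ▸ hk.card_pos)
  exact pos_of_mem_eigs hG (Set.Nonempty.csInf_mem ⟨ρ, hρ⟩ (Multiset.finite_toSet _))

lemma minEig_mul_sum_le (hG : IsUnit (gram X k)) (θ : k → ℝ) :
    minEig X k * ∑ j, gram X k j j * θ j ^ 2 ≤ (design X k *ᵥ θ) ⬝ᵥ (design X k *ᵥ θ) := by
  rw [← dotProduct_transpose_mul_self_mulVec]
  exact mul_sum_le_of_forall_le_root (gram_diag_pos hG) (gram_posDef hG).isHermitian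
    (fun _ => minEig_le) θ

lemma eigProd_pos (hG : IsUnit (gram X k)) {τ : ℝ} (hτ : 0 < τ) : 0 < eigProd X k τ := by
  refine Multiset.prod_pos fun _ hx => ?_
  obtain ⟨ρ, hρ, rfl⟩ := Multiset.mem_map.1 hx
  have := pos_of_mem_eigs hG hρ
  positivity

lemma eigProd_eq_sqrt_det (hG : IsUnit (gram X k)) {τ : ℝ} (hτ : 0 < τ) :
    eigProd X k τ = √(1 + τ • (priorScale X k * gram X k)).det := by
  rw [det_one_add_smul_eq_prod_roots (splits_charpoly_priorScale_mul_gram hG) hτ.ne',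
    Real.sqrt_eq_rpow, ← Real.multiset_prod_map_rpow]
  · rfl
  · intro ρ hρ
    have := pos_of_mem_eigs hG hρ
    positivity

lemma eigProd_eq_sqrt_det_ridgePrecision (hG : IsUnit (gram X k)) {τ : ℝ} (hτ : 0 < τ) :
    eigProd X k τ = √(τ ^ Fintype.card k *
      (ridgePrecision (design X k) (priorWeight X k τ)).det / ∏ j, gram X k j j) := by
  have hdiag : priorScale X k * (priorScale X k)⁻¹ = 1 :=
    Matrix.mul_nonsing_inv _ (Matrix.isUnit_nonsing_inv_det _ (isUnit_det_diagonal_gram hG))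
  have hprec : ridgePrecision (design X k) (priorWeight X k τ) =
      gram X k + τ⁻¹ • (priorScale X k)⁻¹ := by
    rw [inv_priorScale hG, ← Matrix.diagonal_smul]
    rfl
  have hmat : 1 + τ • (priorScale X k * gram X k) =
      τ • (priorScale X k * ridgePrecision (design X k) (priorWeight X k τ)) := by
    rw [hprec, mul_add, Matrix.mul_smul, hdiag, smul_add, smul_smul, mul_inv_cancel₀ hτ.ne',
      one_smul, add_comm]
  rw [eigProd_eq_sqrt_det hG hτ, hmat, Matrix.det_smul, Matrix.det_mul, priorScale,
    Matrix.det_nonsing_inv, Matrix.det_diagonal, Ring.inverse_eq_inv']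
  congr 1
  ring

end Design

section Densities

variable {ι : Type*} [Fintype ι] [DecidableEq ι]

lemma normalPDF_smul_inv (μ x : ι → ℝ) {P : Matrix ι ι ℝ} (hP : 0 < P.det) {φ : ℝ}
    (hφ : 0 < φ) :
    normalPDF μ (φ • P⁻¹) x = Real.exp (-((x - μ) ⬝ᵥ (P *ᵥ (x - μ))) / (2 * φ)) *
      (√P.det / √((2 * Real.pi * φ) ^ Fintype.card ι)) := by
  have hinv : (φ • P⁻¹)⁻¹ = φ⁻¹ • P := by
    refine Matrix.inv_eq_right_inv ?_
    rw [Matrix.smul_mul, Matrix.mul_smul, smul_smul, mul_inv_cancel₀ hφ.ne', one_smul,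
      Matrix.nonsing_inv_mul _ hP.ne'.isUnit]
  have hquad (q : ℝ) : -(1 / 2) * (φ⁻¹ * q) = -q / (2 * φ) := by
    field_simp
  rw [normalPDF, hinv, Matrix.det_smul, Matrix.det_nonsing_inv, Ring.inverse_eq_inv',
    Matrix.smul_mulVec, dotProduct_smul, smul_eq_mul, hquad, ← mul_assoc ((2 * Real.pi) ^ _),
    ← mul_pow, Real.sqrt_mul (by positivity), Real.sqrt_inv, div_mul_eq_div_div, div_inv_eq_mul]
  ring

lemma normalPDF_nonneg (μ x : ι → ℝ) (S : Matrix ι ι ℝ) : 0 ≤ normalPDF μ S x := by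
  unfold normalPDF
  positivity

lemma normalPDF_smul_one_le (μ x : ι → ℝ) {φ : ℝ} (hφ : 0 < φ) :
    normalPDF μ (φ • (1 : Matrix ι ι ℝ)) x ≤ 1 / √((2 * Real.pi * φ) ^ Fintype.card ι) := by
  rw [← inv_one, normalPDF_smul_inv μ x (by simp) hφ, Matrix.one_mulVec, Matrix.det_one,
    Real.sqrt_one]
  refine mul_le_of_le_one_left (by positivity) (Real.exp_le_one_iff.2 ?_)
  have hsq : 0 ≤ (x - μ) ⬝ᵥ (x - μ) := Finset.sum_nonneg fun _ _ => mul_self_nonneg _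
  rw [neg_div]
  exact neg_nonpos.2 (by positivity)

lemma normalPDF_zero_diagonal {v : ι → NNReal} (hv : ∀ j, v j ≠ 0) (θ : ι → ℝ) :
    normalPDF 0 (Matrix.diagonal fun j => (v j : ℝ)) θ =
      ∏ j, gaussianPDFReal 0 (v j) (θ j) := by
  rw [normalPDF, inv_diagonal fun j => NNReal.coe_ne_zero.2 (hv j), sub_zero,
    dotProduct_diagonal_mulVec, Matrix.det_diagonal]
  simp only [gaussianPDFReal, sub_zero, Finset.prod_mul_distrib, ← Real.exp_sum]
  rw [Finset.prod_inv_distrib, ← Real.sqrt_prod _ fun _ _ => by positivity,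
    Finset.prod_mul_distrib, Finset.prod_const, Finset.card_univ, div_eq_inv_mul, Finset.mul_sum]
  congr 2
  exact Finset.sum_congr rfl fun j _ => by ring

lemma integral_gaussianPDFReal_mul_sq_div {v : NNReal} (hv : v ≠ 0) :
    ∫ x, gaussianPDFReal 0 v x * (x ^ 2 / v) = 1 := by
  have hvar : ∫ x, x ^ 2 ∂gaussianReal 0 v = v := by
    rw [← variance_of_integral_eq_zero aemeasurable_id' integral_id_gaussianReal,
      variance_fun_id_gaussianReal]
  have hv' : (v : ℝ) ≠ 0 := NNReal.coe_ne_zero.2 hv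
  rw [← div_self hv']
  nth_rw 2 [← hvar]
  rw [← integral_div, integral_gaussianReal_eq_integral_smul hv]
  simp only [smul_eq_mul]

lemma invGammaPDF_pos {a b φ : ℝ} (ha : 0 < a) (hb : 0 < b) (hφ : 0 < φ) :
    0 < invGammaPDF a b φ := by
  have := Real.Gamma_pos_of_pos ha
  unfold invGammaPDF
  positivity

lemma integrableOn_rpow_mul_exp_neg_div {a b : ℝ} (ha : 0 < a) (hb : 0 < b) :
    IntegrableOn (fun φ : ℝ => φ ^ (-a - 1) * Real.exp (-b / φ)) (Set.Ioi 0) := by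
  have hinv : IntegrableOn (fun x : ℝ => x ^ (a - 1) * Real.exp (-b * x)) (Set.Ioi 0) := by
    simpa using integrableOn_rpow_mul_exp_neg_mul_rpow (s := a - 1) (p := 1) (by linarith)
      one_pos hb
  rw [← integrableOn_Ioi_comp_rpow_iff _ (show (-1 : ℝ) ≠ 0 by norm_num)] at hinv
  refine hinv.congr_fun (fun φ (hφ : 0 < φ) => ?_) measurableSet_Ioi
  simp only [smul_eq_mul, abs_neg, abs_one, one_mul]
  rw [← Real.rpow_mul hφ.le, ← mul_assoc, ← Real.rpow_add hφ, Real.rpow_neg_one, ← div_eq_mul_inv]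
  ring_nf

lemma integrableOn_invGammaPDF {a b : ℝ} (ha : 0 < a) (hb : 0 < b) :
    IntegrableOn (invGammaPDF a b) (Set.Ioi 0) := by
  unfold IntegrableOn invGammaPDF
  simpa only [mul_assoc] using
    (integrableOn_rpow_mul_exp_neg_div ha hb).const_mul (b ^ a / Real.Gamma a)

/-- The factor of the marginal likelihood of `n` observations that depends neither on the model
nor on the data: what remains of the normalising constants when the inverse gamma prior is
updated. -/
def likConst (n : ℕ) (a l : ℝ) : ℝ :=
  (2 * Real.pi) ^ (-(n / 2 : ℝ)) * ((l / 2) ^ (a / 2) / Real.Gamma (a / 2)) *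
    Real.Gamma ((a + n) / 2)

lemma likConst_pos (n : ℕ) {a l : ℝ} (ha : 0 < a) (hl : 0 < l) : 0 < likConst n a l := by
  have := Real.Gamma_pos_of_pos (show 0 < a / 2 by positivity)
  have := Real.Gamma_pos_of_pos (show 0 < (a + n) / 2 by positivity)
  unfold likConst
  positivity

lemma inv_sqrt_pow_mul_invGammaPDF (n : ℕ) {a l φ : ℝ} (ha : 0 < a) (hφ : 0 < φ) :
    1 / √((2 * Real.pi * φ) ^ n) * invGammaPDF (a / 2) (l / 2) φ =
      likConst n a l / Real.Gamma ((a + n) / 2) * φ ^ (-((a + n) / 2) - 1) *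
        Real.exp (-(l / 2) / φ) := by
  have hΓ := (Real.Gamma_pos_of_pos (show 0 < (a + n) / 2 by positivity)).ne'
  have hsqrt : 1 / √((2 * Real.pi * φ) ^ n) =
      (2 * Real.pi) ^ (-(n / 2 : ℝ)) * φ ^ (-(n / 2 : ℝ)) := by
    rw [← Real.mul_rpow (x := 2 * Real.pi) (by positivity) hφ.le, one_div,
      Real.rpow_neg (by positivity), Real.sqrt_eq_rpow, ← Real.rpow_natCast,
      ← Real.rpow_mul (by positivity), mul_one_div]
  have hpow : φ ^ (-((a + n) / 2) - 1) = φ ^ (-(n / 2 : ℝ)) * φ ^ (-(a / 2) - 1) := by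
    rw [← Real.rpow_add hφ]
    ring_nf
  rw [hsqrt, hpow, invGammaPDF, likConst, mul_div_cancel_right₀ _ hΓ]
  ring

lemma exp_neg_div_mul_invGammaPDF (n : ℕ) {a l s φ : ℝ} (ha : 0 < a) (hls : 0 < l + s)
    (hφ : 0 < φ) :
    Real.exp (-s / (2 * φ)) * (1 / √((2 * Real.pi * φ) ^ n)) * invGammaPDF (a / 2) (l / 2) φ =
      likConst n a l * ((l + s) / 2) ^ (-((a + n) / 2)) *
        invGammaPDF ((a + n) / 2) ((l + s) / 2) φ := by
  have hcancel : ((l + s) / 2) ^ (-((a + n) / 2)) * ((l + s) / 2) ^ ((a + n) / 2) = 1 := by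
    rw [← Real.rpow_add (by positivity), neg_add_cancel, Real.rpow_zero]
  have hexp : Real.exp (-((l + s) / 2) / φ) =
      Real.exp (-s / (2 * φ)) * Real.exp (-(l / 2) / φ) := by
    rw [← Real.exp_add]
    congr 1
    field_simp
    ring
  rw [mul_assoc, inv_sqrt_pow_mul_invGammaPDF n ha hφ, invGammaPDF, hexp]
  linear_combination (-(likConst n a l / Real.Gamma ((a + n) / 2) * φ ^ (-((a + n) / 2) - 1) *
    Real.exp (-s / (2 * φ)) * Real.exp (-(l / 2) / φ))) * hcancel

end Densities

section Conjugacy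

variable {ι κ : Type*} [Fintype ι] [DecidableEq ι] [Fintype κ] [DecidableEq κ]
  {A : Matrix ι κ ℝ} {w : κ → ℝ} {φ : ℝ}

lemma normalPDF_mul_normalPDF_eq_ridgeLoss (hw : ∀ j, 0 < w j) (hφ : 0 < φ) (y : ι → ℝ)
    (θ : κ → ℝ) :
    normalPDF (A *ᵥ θ) (φ • (1 : Matrix ι ι ℝ)) y *
        normalPDF 0 (φ • (Matrix.diagonal w)⁻¹) θ =
      Real.exp (-ridgeLoss A w y θ / (2 * φ)) * (1 / √((2 * Real.pi * φ) ^ Fintype.card ι)) *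
        (√(∏ j, w j) / √((2 * Real.pi * φ) ^ Fintype.card κ)) := by
  have hdet : 0 < (Matrix.diagonal w).det := (Matrix.PosDef.diagonal hw).det_pos
  rw [← inv_one, normalPDF_smul_inv _ y (by simp) hφ, normalPDF_smul_inv 0 θ hdet hφ,
    Matrix.one_mulVec, Matrix.det_one, Real.sqrt_one, sub_zero, dotProduct_diagonal_mulVec,
    Matrix.det_diagonal, ridgeLoss, neg_add, add_div, Real.exp_add]
  ring

lemma normalPDF_mul_normalPDF_eq_normalPDF_ridgeEstimator (hw : ∀ j, 0 < w j) (hφ : 0 < φ)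
    (y : ι → ℝ) (θ : κ → ℝ) :
    normalPDF (A *ᵥ θ) (φ • (1 : Matrix ι ι ℝ)) y *
        normalPDF 0 (φ • (Matrix.diagonal w)⁻¹) θ =
      Real.exp (-(y ⬝ᵥ (ridgeResid A w *ᵥ y)) / (2 * φ)) *
        (1 / √((2 * Real.pi * φ) ^ Fintype.card ι)) *
        √((∏ j, w j) / (ridgePrecision A w).det) *
        normalPDF (ridgeEstimator A w y) (φ • (ridgePrecision A w)⁻¹) θ := by
  have hdet : 0 < (ridgePrecision A w).det := (ridgePrecision_posDef hw).det_pos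
  have hsqrt : √(ridgePrecision A w).det ≠ 0 := (Real.sqrt_pos.2 hdet).ne'
  rw [normalPDF_mul_normalPDF_eq_ridgeLoss hw hφ, normalPDF_smul_inv _ θ hdet hφ,
    ridgeLoss_eq hw, neg_add, add_div, Real.exp_add,
    Real.sqrt_div (Finset.prod_nonneg fun j _ => (hw j).le)]
  field_simp

end Conjugacy

section MarginalLikelihood

variable {n p : ℕ} {X : Matrix (Fin n) (Fin p) ℝ} {k : Finset (Fin p)} {τ φ : ℝ}

lemma smul_priorScale (hG : IsUnit (gram X k)) (hτ : 0 < τ) (φ : ℝ) :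
    (τ * φ) • priorScale X k = φ • (Matrix.diagonal (priorWeight X k τ))⁻¹ := by
  rw [priorScale, inv_diagonal fun j => (gram_diag_pos hG j).ne',
    inv_diagonal fun j => (priorWeight_pos hG hτ j).ne', ← Matrix.diagonal_smul,
    ← Matrix.diagonal_smul]
  congr 1
  funext j
  simp only [Pi.smul_apply, smul_eq_mul, priorWeight, mul_inv, inv_inv]
  ring

lemma sqrt_prod_priorWeight_div_det (hG : IsUnit (gram X k)) (hτ : 0 < τ) :
    √((∏ j, priorWeight X k τ j) / (ridgePrecision (design X k) (priorWeight X k τ)).det) =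
      1 / eigProd X k τ := by
  rw [eigProd_eq_sqrt_det_ridgePrecision hG hτ, one_div, ← Real.sqrt_inv]
  simp only [priorWeight, Finset.prod_mul_distrib, Finset.prod_const, Finset.card_univ]
  congr 1
  rw [inv_pow]
  field_simp

lemma likelihood_mul_prior (hG : IsUnit (gram X k)) (hτ : 0 < τ) (hφ : 0 < φ) {a l : ℝ}
    (ha : 0 < a) (hl : 0 < l) (y : Fin n → ℝ) (θ : k → ℝ) :
    normalPDF (design X k *ᵥ θ) (φ • (1 : Matrix (Fin n) (Fin n) ℝ)) y * pMOM X k τ φ θ *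
        invGammaPDF (a / 2) (l / 2) φ =
      likConst n a l * (postSS X k τ l y / 2) ^ (-((a + n) / 2)) / eigProd X k τ *
        (normalPDF (postMean X k τ y) (φ • postScale X k τ) θ *
          invGammaPDF ((a + n) / 2) (postSS X k τ l y / 2) φ * penalty X k τ φ θ) := by
  have hs := postSS_pos hG hτ hl y
  rw [postSS_eq hG] at hs ⊢
  have hnormal := normalPDF_mul_normalPDF_eq_normalPDF_ridgeEstimator (A := design X k)
    (priorWeight_pos hG hτ) hφ y θ
  rw [sqrt_prod_priorWeight_div_det hG hτ, Fintype.card_fin] at hnormal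
  have hgamma := exp_neg_div_mul_invGammaPDF n ha hs hφ
  rw [pMOM, smul_priorScale hG hτ, postMean_eq hG, postScale_eq hG]
  linear_combination (penalty X k τ φ θ * invGammaPDF (a / 2) (l / 2) φ) * hnormal +
    (penalty X k τ φ θ / eigProd X k τ * normalPDF (ridgeEstimator (design X k)
      (priorWeight X k τ) y) (φ • (ridgePrecision (design X k) (priorWeight X k τ))⁻¹) θ) * hgamma

lemma marginalLik_eq (hG : IsUnit (gram X k)) (hτ : 0 < τ) {a l : ℝ} (ha : 0 < a) (hl : 0 < l)
    (y : Fin n → ℝ) :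
    marginalLik X k τ a l y =
      likConst n a l * (postSS X k τ l y / 2) ^ (-((a + n) / 2)) / eigProd X k τ *
        postPenalty X k τ a l y := by
  rw [marginalLik, postPenalty, ← integral_const_mul]
  refine setIntegral_congr_fun measurableSet_Ioi fun φ hφ => ?_
  rw [← integral_const_mul]
  exact integral_congr_ae (ae_of_all _ fun θ => likelihood_mul_prior hG hτ hφ ha hl y θ)

end MarginalLikelihood

section Positivity

variable {n p : ℕ} {X : Matrix (Fin n) (Fin p) ℝ} {k : Finset (Fin p)} {τ φ : ℝ}

variable (X k) in
/-- The prior variances of the coefficients under the normal factor of the pMOM prior. -/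
def priorVariance (τ φ : ℝ) (j : k) : NNReal := (τ * φ / gram X k j j).toNNReal

lemma priorVariance_ne_zero (hG : IsUnit (gram X k)) (hτ : 0 < τ) (hφ : 0 < φ) (j : k) :
    priorVariance X k τ φ j ≠ 0 := by
  have := gram_diag_pos hG j
  exact (Real.toNNReal_pos.2 (by positivity)).ne'

lemma coe_priorVariance (hG : IsUnit (gram X k)) (hτ : 0 < τ) (hφ : 0 < φ) (j : k) :
    (priorVariance X k τ φ j : ℝ) = τ * φ / gram X k j j := by
  have := gram_diag_pos hG j
  exact Real.coe_toNNReal _ (by positivity)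

lemma pMOM_eq_prod (hG : IsUnit (gram X k)) (hτ : 0 < τ) (hφ : 0 < φ) (θ : k → ℝ) :
    pMOM X k τ φ θ = ∏ j, gaussianPDFReal 0 (priorVariance X k τ φ j) (θ j) *
      (θ j ^ 2 / priorVariance X k τ φ j) := by
  have hcov : (τ * φ) • priorScale X k =
      Matrix.diagonal fun j => (priorVariance X k τ φ j : ℝ) := by
    rw [priorScale, inv_diagonal fun j => (gram_diag_pos hG j).ne', ← Matrix.diagonal_smul]
    congr 1
    funext j
    rw [coe_priorVariance hG hτ hφ, div_eq_mul_inv]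
    rfl
  rw [pMOM, penalty, hcov, normalPDF_zero_diagonal (priorVariance_ne_zero hG hτ hφ),
    ← Finset.prod_mul_distrib]
  refine Finset.prod_congr rfl fun j _ => ?_
  rw [coe_priorVariance hG hτ hφ, div_div_eq_mul_div]

lemma pMOM_nonneg (hG : IsUnit (gram X k)) (hτ : 0 < τ) (hφ : 0 < φ) (θ : k → ℝ) :
    0 ≤ pMOM X k τ φ θ := by
  rw [pMOM_eq_prod hG hτ hφ]
  exact Finset.prod_nonneg fun j _ => mul_nonneg (gaussianPDFReal_nonneg _ _ _) (by positivity)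

lemma integral_pMOM (hG : IsUnit (gram X k)) (hτ : 0 < τ) (hφ : 0 < φ) :
    ∫ θ, pMOM X k τ φ θ = 1 := by
  simp only [pMOM_eq_prod hG hτ hφ]
  rw [integral_fintype_prod_volume_eq_prod
    (f := fun j x => gaussianPDFReal 0 (priorVariance X k τ φ j) x *
      (x ^ 2 / priorVariance X k τ φ j))]
  exact Finset.prod_eq_one fun j _ =>
    integral_gaussianPDFReal_mul_sq_div (priorVariance_ne_zero hG hτ hφ j)

variable (X k) in
/-- The likelihood of `M_k` given the error variance `φ`, i.e. with only `θ_k` integrated out. -/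
def conditionalLik (τ φ : ℝ) (y : Fin n → ℝ) : ℝ :=
  ∫ θ : k → ℝ, normalPDF (design X k *ᵥ θ) (φ • (1 : Matrix (Fin n) (Fin n) ℝ)) y *
    pMOM X k τ φ θ

lemma marginalLik_eq_integral_conditionalLik (a l : ℝ) (y : Fin n → ℝ) :
    marginalLik X k τ a l y =
      ∫ φ in Set.Ioi 0, conditionalLik X k τ φ y * invGammaPDF (a / 2) (l / 2) φ := by
  simp only [marginalLik, conditionalLik, integral_mul_const]

lemma integrable_likelihood_mul_pMOM (hG : IsUnit (gram X k)) (hτ : 0 < τ) (hφ : 0 < φ)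
    (y : Fin n → ℝ) :
    Integrable fun θ : k → ℝ => normalPDF (design X k *ᵥ θ)
      (φ • (1 : Matrix (Fin n) (Fin n) ℝ)) y * pMOM X k τ φ θ := by
  refine (integrable_of_integral_eq_one (integral_pMOM hG hτ hφ)).bdd_mul
    (c := 1 / √((2 * Real.pi * φ) ^ n)) ?_ (ae_of_all _ fun θ => ?_)
  · unfold normalPDF
    fun_prop
  · rw [Real.norm_of_nonneg (normalPDF_nonneg _ _ _)]
    simpa only [Fintype.card_fin] using normalPDF_smul_one_le (design X k *ᵥ θ) y hφ

lemma conditionalLik_le (hG : IsUnit (gram X k)) (hτ : 0 < τ) (hφ : 0 < φ) (y : Fin n → ℝ) :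
    conditionalLik X k τ φ y ≤ 1 / √((2 * Real.pi * φ) ^ n) := by
  have hpMOM := integrable_of_integral_eq_one (integral_pMOM hG hτ hφ)
  calc conditionalLik X k τ φ y ≤ ∫ θ, 1 / √((2 * Real.pi * φ) ^ n) * pMOM X k τ φ θ := by
        refine integral_mono (integrable_likelihood_mul_pMOM hG hτ hφ y)
          (hpMOM.const_mul _) fun θ => mul_le_mul_of_nonneg_right ?_ (pMOM_nonneg hG hτ hφ θ)
        simpa only [Fintype.card_fin] using normalPDF_smul_one_le (design X k *ᵥ θ) y hφ
    _ = 1 / √((2 * Real.pi * φ) ^ n) := by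
        rw [integral_const_mul, integral_pMOM hG hτ hφ, mul_one]

lemma conditionalLik_pos (hG : IsUnit (gram X k)) (hτ : 0 < τ) (hφ : 0 < φ) (y : Fin n → ℝ) :
    0 < conditionalLik X k τ φ y := by
  have hlik (θ : k → ℝ) :
      0 < normalPDF (design X k *ᵥ θ) (φ • (1 : Matrix (Fin n) (Fin n) ℝ)) y := by
    rw [← inv_one, normalPDF_smul_inv _ _ (by simp) hφ, Matrix.det_one]
    positivity
  refine integral_pos_of_integrable_nonneg_nonzero (x := 1) ?_
    (integrable_likelihood_mul_pMOM hG hτ hφ y)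
    (fun θ => mul_nonneg (hlik θ).le (pMOM_nonneg hG hτ hφ θ)) (mul_pos (hlik 1) ?_).ne'
  · unfold pMOM normalPDF penalty
    fun_prop
  · rw [pMOM_eq_prod hG hτ hφ]
    refine Finset.prod_pos fun j _ => ?_
    have hv := priorVariance_ne_zero hG hτ hφ j
    have := gaussianPDFReal_pos 0 _ (1 : ℝ) hv
    simp only [Pi.one_apply]
    positivity

lemma aestronglyMeasurable_conditionalLik (hG : IsUnit (gram X k)) (hτ : 0 < τ)
    (y : Fin n → ℝ) :
    AEStronglyMeasurable (fun φ => conditionalLik X k τ φ y) (volume.restrict (Set.Ioi 0)) := by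
  have hmeas : Measurable fun z : ℝ × (k → ℝ) =>
      Real.exp (-ridgeLoss (design X k) (priorWeight X k τ) y z.2 / (2 * z.1)) *
        (1 / √((2 * Real.pi * z.1) ^ Fintype.card (Fin n))) *
        (√(∏ j, priorWeight X k τ j) / √((2 * Real.pi * z.1) ^ Fintype.card k)) *
        penalty X k τ z.1 z.2 := by
    unfold ridgeLoss penalty Matrix.mulVec dotProduct
    fun_prop
  refine (hmeas.stronglyMeasurable.integral_prod_right' (ν := volume)).aestronglyMeasurable.congr ?_
  filter_upwards [ae_restrict_mem measurableSet_Ioi] with φ hφ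
  refine integral_congr_ae (ae_of_all _ fun θ => ?_)
  simp only [pMOM, smul_priorScale hG hτ, ← mul_assoc]
  rw [normalPDF_mul_normalPDF_eq_ridgeLoss (priorWeight_pos hG hτ) hφ]

lemma marginalLik_pos (hG : IsUnit (gram X k)) (hτ : 0 < τ) {a l : ℝ} (ha : 0 < a) (hl : 0 < l)
    (y : Fin n → ℝ) : 0 < marginalLik X k τ a l y := by
  have hIG {φ : ℝ} (hφ : 0 < φ) : 0 < invGammaPDF (a / 2) (l / 2) φ :=
    invGammaPDF_pos (by positivity) (by positivity) hφ
  have hpos {φ : ℝ} (hφ : 0 < φ) :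
      0 < conditionalLik X k τ φ y * invGammaPDF (a / 2) (l / 2) φ :=
    mul_pos (conditionalLik_pos hG hτ hφ y) (hIG hφ)
  have hint : IntegrableOn (fun φ => conditionalLik X k τ φ y * invGammaPDF (a / 2) (l / 2) φ)
      (Set.Ioi 0) := by
    refine (integrableOn_rpow_mul_exp_neg_div (show 0 < (a + n) / 2 by positivity)
      (half_pos hl)).const_mul (likConst n a l / Real.Gamma ((a + n) / 2)) |>.mono'
      ((aestronglyMeasurable_conditionalLik hG hτ y).mul
        (integrableOn_invGammaPDF (half_pos ha) (half_pos hl)).aestronglyMeasurable) ?_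
    filter_upwards [ae_restrict_mem measurableSet_Ioi] with φ hφ
    rw [Real.norm_of_nonneg (hpos hφ).le, ← mul_assoc, ← inv_sqrt_pow_mul_invGammaPDF n ha hφ]
    exact mul_le_mul_of_nonneg_right (conditionalLik_le hG hτ hφ y) (hIG hφ).le
  rw [marginalLik_eq_integral_conditionalLik, setIntegral_pos_iff_support_of_nonneg_ae
    (ae_restrict_of_forall_mem measurableSet_Ioi fun φ hφ => (hpos hφ).le) hint]
  exact measure_pos_of_superset (s := Set.Ioi 0) (fun φ hφ => ⟨(hpos hφ).ne', hφ⟩) (by simp)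

end Positivity

section Nested

open Module

variable {n p : ℕ} {X : Matrix (Fin n) (Fin p) ℝ} {t m : Finset (Fin p)} {τ φ l : ℝ}

lemma sum_priorWeight_mul_sq_le (hG : IsUnit (gram X t)) (ht : t.Nonempty) (hτ : 0 < τ)
    (θ : t → ℝ) :
    ∑ j, priorWeight X t τ j * θ j ^ 2 ≤
      (design X t *ᵥ θ) ⬝ᵥ (design X t *ᵥ θ) / (τ * minEig X t) := by
  have hρ := minEig_pos hG ht
  rw [le_div_iff₀ (by positivity)]
  refine le_of_eq_of_le ?_ (minEig_mul_sum_le hG θ)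
  simp only [priorWeight, mul_assoc, ← Finset.mul_sum]
  field_simp

/-- The inclusion of the columns of a submodel into those of a larger model. -/
abbrev columnEmbedding (htm : t ⊆ m) : t ↪ m := Subtype.impEmbedding _ _ htm

lemma postSS_div_postSS_le (hGt : IsUnit (gram X t)) (hGm : IsUnit (gram X m)) (htm : t ⊆ m)
    (ht : t.Nonempty) (hτ : 0 < τ) (hφ : 0 < φ) (hl : 0 < l) {δ : ℝ} (hδ : 0 < δ)
    (θ : t → ℝ) (v : EuclideanSpace ℝ (Fin n)) :
    postSS X t τ l (design X t *ᵥ θ + √φ • v.ofLp) /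
        postSS X m τ l (design X t *ᵥ θ + √φ • v.ofLp) ≤
      1 + ((1 + δ) * ‖(ridgeDropSpace (design X m) (priorWeight X m τ)
            (columnEmbedding htm)).orthogonalProjectionOnto v‖ ^ 2 +
          (1 + 1 / δ) * ((design X t *ᵥ θ) ⬝ᵥ (design X t *ᵥ θ) / φ / (τ * minEig X t))) /
        (l / φ + ‖(LinearMap.ker (Matrix.toEuclideanLin
            (design X m)ᵀ)).orthogonalProjectionOnto v‖ ^ 2) := by
  have hratio := ridgeResid_ratio_le (A := design X m) (columnEmbedding htm)
    (priorWeight_pos hGm hτ) hδ hl θ (√φ • v) rfl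
  have hsum := sum_priorWeight_mul_sq_le hGt ht hτ θ
  have hscale (K : Submodule ℝ (EuclideanSpace ℝ (Fin n))) :
      ‖K.orthogonalProjectionOnto (√φ • v)‖ ^ 2 = φ * ‖K.orthogonalProjectionOnto v‖ ^ 2 := by
    rw [map_smul, norm_smul, mul_pow, Real.norm_of_nonneg (Real.sqrt_nonneg _), Real.sq_sqrt hφ.le]
  rw [hscale, hscale] at hratio
  rw [postSS_eq hGt, postSS_eq hGm]
  refine hratio.trans ?_
  rw [← mul_div_mul_left _ (l / φ + _) hφ.ne', mul_add φ (l / φ), mul_div_cancel₀ _ hφ.ne']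
  gcongr 1 + ?_ / _
  calc _ ≤ (1 + δ) * (φ * ‖(ridgeDropSpace (design X m) (priorWeight X m τ)
          (columnEmbedding htm)).orthogonalProjectionOnto v‖ ^ 2) +
        (1 + 1 / δ) * ((design X t *ᵥ θ) ⬝ᵥ (design X t *ᵥ θ) / (τ * minEig X t)) := by
        gcongr
        exact hsum
    _ = _ := by
        field_simp

lemma truth_eq_map_stdGaussian {n : ℕ} (μ : Fin n → ℝ) {φ : ℝ} (hφ : 0 < φ) :
    truth μ φ = (stdGaussian (EuclideanSpace ℝ (Fin n))).map fun v => μ + √φ • v.ofLp := by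
  have haffine (i : Fin n) : (gaussianReal 0 1).map (fun x => μ i + √φ * x) =
      gaussianReal (μ i) φ.toNNReal := by
    have hcomp : (fun x => μ i + √φ * x) = (fun x => μ i + x) ∘ fun x => √φ * x := rfl
    rw [hcomp, ← Measure.map_map (by fun_prop) (by fun_prop), gaussianReal_map_const_mul,
      gaussianReal_map_const_add]
    congr 1
    · ring
    · ext
      simp [Real.sq_sqrt hφ.le, hφ.le]
  rw [← map_pi_eq_stdGaussian, Measure.map_map (by fun_prop) (by fun_prop), truth]
  simp_rw [← haffine]
  rw [← Measure.pi_map_pi fun i => by fun_prop]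
  rfl

lemma lintegral_postSS_div_postSS_rpow_le (hGt : IsUnit (gram X t)) (hGm : IsUnit (gram X m))
    (htm : t ⊆ m) (ht : t.Nonempty) (hτ : 0 < τ) (hφ : 0 < φ) (hl : 0 < l) (θ₀ : t → ℝ)
    {γ θ δ : ℝ} (hγ : 0 ≤ γ) (hθ : 0 < θ) (hθ1 : θ ≤ 1) (hδ : 0 < δ) (hδθ : θ * (1 + δ) < 1)
    (hd : 2 * (γ / θ) + 2 + m.card ≤ n) :
    ∫⁻ y, ENNReal.ofReal ((postSS X t τ l y / postSS X m τ l y) ^ γ)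
        ∂truth (design X t *ᵥ θ₀) φ ≤
      ENNReal.ofReal (Real.exp (θ * ((1 + 1 / δ) *
          ((design X t *ᵥ θ₀) ⬝ᵥ (design X t *ᵥ θ₀) / φ / (τ * minEig X t))) / 2) *
        (1 - θ * (1 + δ)) ^ (-(((m.card : ℝ) - t.card) / 2))) := by
  have hρ := minEig_pos hGt ht
  have hmean : 0 ≤ (design X t *ᵥ θ₀) ⬝ᵥ (design X t *ᵥ θ₀) :=
    Finset.sum_nonneg fun _ _ => mul_self_nonneg _
  have hK := card_le_finrank_ker_transpose_add (design X m)
  have hU := finrank_ridgeDropSpace_le (A := design X m) (columnEmbedding htm)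
    (priorWeight_pos hGm hτ)
  rw [Fintype.card_fin, Fintype.card_coe, ← Nat.cast_le (α := ℝ), Nat.cast_add] at hK
  rw [Fintype.card_coe, Fintype.card_coe, ← Nat.cast_le (α := ℝ), Nat.cast_add] at hU
  rw [truth_eq_map_stdGaussian _ hφ]
  refine (lintegral_map_le _ _).trans <| (lintegral_mono fun v => ?_).trans <|
    (lintegral_rpow_projection_ratio_le (l := l / φ) (η := (1 + 1 / δ) *
          ((design X t *ᵥ θ₀) ⬝ᵥ (design X t *ᵥ θ₀) / φ / (τ * minEig X t)))
      (ker_transpose_isOrtho_ridgeDropSpace (columnEmbedding htm) (priorWeight_pos hGm hτ))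
      (by positivity) hγ hθ hθ1 (by positivity) (by positivity) hδθ
      (le_of_add_le_add_right (hd.trans hK))).trans ?_
  · refine ENNReal.ofReal_le_ofReal (Real.rpow_le_rpow ?_ ?_ hγ)
    · exact (div_pos (postSS_pos hGt hτ hl _) (postSS_pos hGm hτ hl _)).le
    · exact postSS_div_postSS_le hGt hGm htm ht hτ hφ hl hδ θ₀ v
  · gcongr ENNReal.ofReal (_ * ?_)
    refine Real.rpow_le_rpow_of_exponent_ge (sub_pos.2 hδθ) (sub_le_self _ (by positivity)) ?_
    gcongr
    exact le_sub_iff_add_le.2 hU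

end Nested

section PosteriorOdds

lemma min_one_le_rpow {B α : ℝ} (hB : 0 ≤ B) (hα0 : 0 ≤ α) (hα1 : α ≤ 1) :
    min 1 B ≤ B ^ α := by
  rcases le_total B 1 with hle | hle
  · exact (min_le_right _ _).trans (Real.self_le_rpow_of_le_one hB hle hα1)
  · exact (min_le_left _ _).trans (Real.one_le_rpow hle hα0)

lemma integral_le_mul_add_measureReal {Ω : Type*} [MeasurableSpace Ω] {μ : Measure Ω}
    [IsFiniteMeasure μ] {f g : Ω → ℝ} {S : Set Ω} {A B : ℝ} (hf : ∀ y, 0 ≤ f y)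
    (hfS : ∀ y ∈ S, f y ≤ 1) (hfg : ∀ y ∉ S, f y ≤ A * g y) (hA : 0 ≤ A) (hB : 0 ≤ B)
    (hg : Measurable g) (hgB : ∫⁻ y, ENNReal.ofReal (g y) ∂μ ≤ ENNReal.ofReal B) :
    ∫ y, f y ∂μ ≤ A * B + μ.real S := by
  have hpoint (y : Ω) : ENNReal.ofReal (f y) ≤
      ENNReal.ofReal A * ENNReal.ofReal (g y) + S.indicator 1 y := by
    by_cases hy : y ∈ S
    · rw [Set.indicator_of_mem hy]
      exact le_add_left (ENNReal.ofReal_le_one.2 (hfS y hy))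
    · rw [Set.indicator_of_notMem hy, add_zero, ← ENNReal.ofReal_mul hA]
      exact ENNReal.ofReal_le_ofReal (hfg y hy)
  have hle : ∫⁻ y, ENNReal.ofReal (f y) ∂μ ≤ ENNReal.ofReal A * ENNReal.ofReal B + μ S := by
    refine (lintegral_mono hpoint).trans ?_
    rw [lintegral_add_left (by fun_prop), lintegral_const_mul' _ _ ENNReal.ofReal_ne_top]
    exact add_le_add (mul_le_mul_right hgB _) (lintegral_indicator_one_le S)
  have hbound : ENNReal.ofReal A * ENNReal.ofReal B ≠ ⊤ :=
    ENNReal.mul_ne_top ENNReal.ofReal_ne_top ENNReal.ofReal_ne_top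
  calc ∫ y, f y ∂μ ≤ (∫⁻ y, ENNReal.ofReal (f y) ∂μ).toReal := by
        simpa only [Real.norm_of_nonneg (hf _)] using
          (Real.le_norm_self _).trans (norm_integral_le_lintegral_norm (μ := μ) f)
    _ ≤ (ENNReal.ofReal A * ENNReal.ofReal B + μ S).toReal :=
        ENNReal.toReal_mono (ENNReal.add_ne_top.2 ⟨hbound, measure_ne_top _ _⟩) hle
    _ = A * B + μ.real S := by
        rw [ENNReal.toReal_add hbound (measure_ne_top _ _), ENNReal.toReal_mul,
          ENNReal.toReal_ofReal hA, ENNReal.toReal_ofReal hB, Measure.real]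

lemma measurable_postSS {n p : ℕ} (X : Matrix (Fin n) (Fin p) ℝ) (k : Finset (Fin p))
    (τ l : ℝ) : Measurable (postSS X k τ l) := by
  have hcont : Continuous (postSS X k τ l) := by
    unfold postSS
    fun_prop
  exact hcont.measurable

namespace Problem

variable {n : ℕ} {P : Problem n} {a l : ℝ}

instance : IsProbabilityMeasure P.law := by
  unfold law truth
  infer_instance

namespace IsAdmissible

lemma r_pos (hP : P.IsAdmissible) : 0 < P.r :=
  div_pos (hP.prior_pos _ hP.m_mem) (hP.prior_pos _ hP.t_mem)

lemma one_le_excess (hP : P.IsAdmissible) : 1 ≤ P.excess := by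
  have hcard : P.t.card + 1 ≤ P.m.card := Finset.card_lt_card hP.t_ssubset_m
  rw [← Nat.cast_le (α := ℝ), Nat.cast_add, Nat.cast_one] at hcard
  unfold excess
  linarith

lemma eigProd_div_eigProd_pos (hP : P.IsAdmissible) :
    0 < eigProd P.X P.m P.τ / eigProd P.X P.t P.τ :=
  div_pos (eigProd_pos (hP.gram_isUnit _ hP.m_mem) hP.tau_pos)
    (eigProd_pos (hP.gram_isUnit _ hP.t_mem) hP.tau_pos)

lemma marginalLik_mul_prior_pos (hP : P.IsAdmissible) (ha : 0 < a) (hl : 0 < l)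
    (y : Fin n → ℝ) {k : Finset (Fin P.p)} (hk : k ∈ P.models) :
    0 < marginalLik P.X k P.τ a l y * P.prior k :=
  mul_pos (marginalLik_pos (hP.gram_isUnit k hk) hP.tau_pos ha hl y) (hP.prior_pos k hk)

lemma marginalLik_mul_prior_le_sum (hP : P.IsAdmissible) (ha : 0 < a) (hl : 0 < l)
    (y : Fin n → ℝ) {k : Finset (Fin P.p)} (hk : k ∈ P.models) :
    marginalLik P.X k P.τ a l y * P.prior k ≤
      ∑ i ∈ P.models, marginalLik P.X i P.τ a l y * P.prior i :=
  Finset.single_le_sum (f := fun i => marginalLik P.X i P.τ a l y * P.prior i)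
    (fun _ hi => (hP.marginalLik_mul_prior_pos ha hl y hi).le) hk

lemma postProb_nonneg (hP : P.IsAdmissible) (ha : 0 < a) (hl : 0 < l) (y : Fin n → ℝ) :
    0 ≤ postProb P.X P.m P.models P.prior P.τ a l y :=
  div_nonneg (hP.marginalLik_mul_prior_pos ha hl y hP.m_mem).le
    (Finset.sum_nonneg fun _ hi => (hP.marginalLik_mul_prior_pos ha hl y hi).le)

lemma postProb_le_one (hP : P.IsAdmissible) (ha : 0 < a) (hl : 0 < l) (y : Fin n → ℝ) :
    postProb P.X P.m P.models P.prior P.τ a l y ≤ 1 :=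
  div_le_one_of_le₀ (hP.marginalLik_mul_prior_le_sum ha hl y hP.m_mem)
    (Finset.sum_nonneg fun _ hi => (hP.marginalLik_mul_prior_pos ha hl y hi).le)

lemma postProb_le_odds (hP : P.IsAdmissible) (ha : 0 < a) (hl : 0 < l) (y : Fin n → ℝ) :
    postProb P.X P.m P.models P.prior P.τ a l y ≤
      marginalLik P.X P.m P.τ a l y * P.prior P.m /
        (marginalLik P.X P.t P.τ a l y * P.prior P.t) :=
  div_le_div_of_nonneg_left (hP.marginalLik_mul_prior_pos ha hl y hP.m_mem).le
    (hP.marginalLik_mul_prior_pos ha hl y hP.t_mem)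
    (hP.marginalLik_mul_prior_le_sum ha hl y hP.t_mem)

lemma odds_eq (hP : P.IsAdmissible) (ha : 0 < a) (hl : 0 < l) (y : Fin n → ℝ) :
    marginalLik P.X P.m P.τ a l y * P.prior P.m / (marginalLik P.X P.t P.τ a l y * P.prior P.t) =
      P.r * penaltyRatio P.X P.m P.t P.τ a l y / (eigProd P.X P.m P.τ / eigProd P.X P.t P.τ) *
        (postSS P.X P.t P.τ l y / postSS P.X P.m P.τ l y) ^ ((a + n) / 2) := by
  have hGt := hP.gram_isUnit _ hP.t_mem
  have hGm := hP.gram_isUnit _ hP.m_mem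
  have hst := half_pos (postSS_pos hGt hP.tau_pos hl y)
  have hsm := half_pos (postSS_pos hGm hP.tau_pos hl y)
  have hLik := likConst_pos n ha hl
  have hhalf : postSS P.X P.t P.τ l y / postSS P.X P.m P.τ l y =
      (postSS P.X P.t P.τ l y / 2) / (postSS P.X P.m P.τ l y / 2) :=
    (div_div_div_cancel_right₀ two_ne_zero _ _).symm
  rw [marginalLik_eq hGt hP.tau_pos ha hl, marginalLik_eq hGm hP.tau_pos ha hl, hhalf, r,
    penaltyRatio, Real.div_rpow hst.le hsm.le, Real.rpow_neg hst.le, Real.rpow_neg hsm.le]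
  field_simp

lemma postProb_le (hP : P.IsAdmissible) (ha : 0 < a) (hl : 0 < l) {H α : ℝ} (hα0 : 0 ≤ α)
    (hα1 : α ≤ 1) (hH : 0 ≤ H) (y : Fin n → ℝ) (hy : penaltyRatio P.X P.m P.t P.τ a l y ≤ H) :
    postProb P.X P.m P.models P.prior P.τ a l y ≤
      (P.r * H / (eigProd P.X P.m P.τ / eigProd P.X P.t P.τ)) ^ α *
        (postSS P.X P.t P.τ l y / postSS P.X P.m P.τ l y) ^ (α * ((a + n) / 2)) := by
  have hr := hP.r_pos
  have hE := hP.eigProd_div_eigProd_pos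
  have hst := postSS_pos (hP.gram_isUnit _ hP.t_mem) hP.tau_pos hl y
  have hsm := postSS_pos (hP.gram_isUnit _ hP.m_mem) hP.tau_pos hl y
  have hodds : postProb P.X P.m P.models P.prior P.τ a l y ≤
      P.r * H / (eigProd P.X P.m P.τ / eigProd P.X P.t P.τ) *
        (postSS P.X P.t P.τ l y / postSS P.X P.m P.τ l y) ^ ((a + n) / 2) := by
    refine (hP.postProb_le_odds ha hl y).trans ?_
    rw [hP.odds_eq ha hl]
    gcongr
  refine (le_min (hP.postProb_le_one ha hl y) hodds).trans ?_
  refine (min_one_le_rpow (by positivity) hα0 hα1).trans_eq ?_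
  rw [Real.mul_rpow (by positivity) (by positivity), ← Real.rpow_mul (by positivity), mul_comm α]

lemma integral_postProb_le (hP : P.IsAdmissible) (ha : 0 < a) (hl : 0 < l) {H α θ δ : ℝ}
    (hH : 0 ≤ H) (hα0 : 0 ≤ α) (hα1 : α ≤ 1) (hθ : 0 < θ) (hθ1 : θ ≤ 1) (hδ : 0 < δ)
    (hδθ : θ * (1 + δ) < 1) (hd : 2 * (α * ((a + n) / 2) / θ) + 2 + P.m.card ≤ n) :
    ∫ y, postProb P.X P.m P.models P.prior P.τ a l y ∂P.law ≤
      (P.r * H / (eigProd P.X P.m P.τ / eigProd P.X P.t P.τ)) ^ α *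
        (Real.exp (θ * ((1 + 1 / δ) * (P.noncentrality / (P.τ * minEig P.X P.t))) / 2) *
          (1 - θ * (1 + δ)) ^ (-(P.excess / 2))) +
      P.law.real {y | H < penaltyRatio P.X P.m P.t P.τ a l y} := by
  have hr := hP.r_pos
  have hE := hP.eigProd_div_eigProd_pos
  have := sub_pos.2 hδθ
  have hmeas := measurable_postSS P.X P.t P.τ l
  have hmeas' := measurable_postSS P.X P.m P.τ l
  refine integral_le_mul_add_measureReal (hP.postProb_nonneg ha hl)
    (fun y _ => hP.postProb_le_one ha hl y)
    (fun y hy => hP.postProb_le ha hl hα0 hα1 hH y (not_lt.1 hy)) (by positivity) (by positivity)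
    (by fun_prop) ?_
  exact lintegral_postSS_div_postSS_rpow_le (hP.gram_isUnit _ hP.t_mem)
    (hP.gram_isUnit _ hP.m_mem) hP.t_ssubset_m.subset hP.t_nonempty hP.tau_pos hP.phi_pos hl
    P.θstar (by positivity) hθ hθ1 hδ hδθ hd

end IsAdmissible

end Problem

end PosteriorOdds

section Rate

lemma exists_pos_eventually_le_mul {ι : Type*} {𝓕 : Filter ι} {f g : ι → ℝ} (hfg : f =O[𝓕] g)
    (hg : ∀ᶠ i in 𝓕, 0 ≤ g i) : ∃ C, 0 < C ∧ ∀ᶠ i in 𝓕, f i ≤ C * g i := by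
  obtain ⟨C, hC, hbound⟩ := hfg.exists_pos
  refine ⟨C, hC, ?_⟩
  filter_upwards [hbound.bound, hg] with i hi hgi
  exact (Real.le_norm_self _).trans (hi.trans_eq (by rw [Real.norm_of_nonneg hgi]))

lemma eventually_two_mul_div_add_le {k : ℕ → ℝ} (hk : k =o[atTop] fun n => (n : ℝ)) {α θ : ℝ}
    (a : ℝ) (hθ : 0 < θ) (hαθ : α < θ) :
    ∀ᶠ n : ℕ in atTop, 2 * (α * ((a + n) / 2) / θ) + 2 + k n ≤ (n : ℝ) := by
  have hε : 0 < (1 - α / θ) / 2 := half_pos (sub_pos.2 ((div_lt_one hθ).2 hαθ))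
  filter_upwards [hk.bound hε, (tendsto_natCast_atTop_atTop (R := ℝ)).eventually_ge_atTop
    ((α * a / θ + 2) / ((1 - α / θ) / 2))] with n hkn hn
  rw [Real.norm_of_nonneg n.cast_nonneg] at hkn
  rw [div_le_iff₀ hε] at hn
  have hsplit : 2 * (α * ((a + n) / 2) / θ) = α * a / θ + (1 - 2 * ((1 - α / θ) / 2)) * n := by
    field_simp
    ring
  rw [hsplit]
  linarith [(Real.le_norm_self (k n)).trans hkn]

lemma rpow_mul_rpow_neg_mul_rpow_neg_le {r h τ q C α α' : ℝ} (hr : 0 < r) (hh : 0 < h)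
    (hτ : 0 < τ) (hα : α ≤ α') (hrτ : r ≤ C * τ ^ (q / 2)) :
    (r * h ^ (-q) * τ ^ (-(q / 2))) ^ α' ≤
      (C * h ^ (-q)) ^ (α' - α) * (r ^ α * (h * √τ) ^ (-(α * q))) := by
  set x := r * h ^ (-q) * τ ^ (-(q / 2)) with hx
  have hx0 : 0 < x := by positivity
  have hxle : x ≤ C * h ^ (-q) := by
    calc x ≤ C * τ ^ (q / 2) * h ^ (-q) * τ ^ (-(q / 2)) := by rw [hx]; gcongr
      _ = C * h ^ (-q) * (τ ^ (q / 2) * τ ^ (-(q / 2))) := by ring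
      _ = C * h ^ (-q) := by rw [← Real.rpow_add hτ, add_neg_cancel, Real.rpow_zero, mul_one]
  have hxα : x ^ α = r ^ α * (h * √τ) ^ (-(α * q)) := by
    rw [hx, Real.mul_rpow (by positivity) (by positivity), Real.mul_rpow hr.le (by positivity),
      Real.mul_rpow hh.le (by positivity), Real.sqrt_eq_rpow, ← Real.rpow_mul hh.le,
      ← Real.rpow_mul hτ.le, ← Real.rpow_mul hτ.le]
    ring_nf
  calc x ^ α' = x ^ (α' - α) * x ^ α := by rw [← Real.rpow_add hx0, sub_add_cancel]
    _ ≤ (C * h ^ (-q)) ^ (α' - α) * x ^ α := by gcongr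
    _ = _ := by rw [hxα]

/- The exponent `α' > α` leaves the spare factor `h ^ (-(α' - α) q)`, which absorbs the geometric
factors `c ^ (-α' q / 2)` and `κ ^ (-q / 2)` even when `q` is unbounded. -/
lemma rpow_mul_rpow_le_rate {r h τ q R c C₁ C₂ κ α α' : ℝ} (hr : 0 < r) (hh : 0 < h)
    (hτ : 0 < τ) (hR : 0 < R) (hc : 0 < c) (hC₁ : 0 < C₁) (hC₂ : 0 < C₂) (hκ : 0 < κ)
    (hα : α ≤ α') (hα' : 0 ≤ α') (hrτ : r ≤ C₁ * τ ^ (q / 2))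
    (hcR : (c * τ) ^ (q / 2) ≤ C₂ * R) :
    (r * (1 / h ^ q) / R) ^ α' * κ ^ (-(q / 2)) ≤
      C₁ ^ (α' - α) * C₂ ^ α' * (c ^ (-(α' / 2)) * κ ^ (-(1 / 2) : ℝ) * h ^ (-(α' - α))) ^ q *
        (r ^ α * (h * √τ) ^ (-(α * q))) := by
  have hinv : 1 / R ≤ C₂ * (c * τ) ^ (-(q / 2)) := by
    rw [Real.rpow_neg (by positivity), ← div_eq_mul_inv]
    exact (div_le_div_iff₀ hR (by positivity)).2 (by rwa [one_mul])
  have hbase : r * (1 / h ^ q) / R ≤ C₂ * c ^ (-(q / 2)) * (r * h ^ (-q) * τ ^ (-(q / 2))) := by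
    calc r * (1 / h ^ q) / R = r * h ^ (-q) * (1 / R) := by rw [Real.rpow_neg hh.le]; ring
      _ ≤ r * h ^ (-q) * (C₂ * (c * τ) ^ (-(q / 2))) := by gcongr
      _ = C₂ * c ^ (-(q / 2)) * (r * h ^ (-q) * τ ^ (-(q / 2))) := by
          rw [Real.mul_rpow hc.le hτ.le]
          ring
  have hgeom : (c ^ (-(α' / 2)) * κ ^ (-(1 / 2) : ℝ) * h ^ (-(α' - α))) ^ q =
      (c ^ (-(q / 2))) ^ α' * κ ^ (-(q / 2)) * (h ^ (-q)) ^ (α' - α) := by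
    rw [Real.mul_rpow (by positivity) (by positivity),
      Real.mul_rpow (by positivity) (by positivity)]
    simp only [← Real.rpow_mul hc.le, ← Real.rpow_mul hκ.le, ← Real.rpow_mul hh.le]
    ring_nf
  calc (r * (1 / h ^ q) / R) ^ α' * κ ^ (-(q / 2)) ≤
        (C₂ * c ^ (-(q / 2)) * (r * h ^ (-q) * τ ^ (-(q / 2)))) ^ α' * κ ^ (-(q / 2)) := by gcongr
    _ ≤ C₂ ^ α' * (c ^ (-(q / 2))) ^ α' *
        ((C₁ * h ^ (-q)) ^ (α' - α) * (r ^ α * (h * √τ) ^ (-(α * q)))) * κ ^ (-(q / 2)) := by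
        rw [Real.mul_rpow (by positivity) (by positivity), Real.mul_rpow hC₂.le (by positivity)]
        gcongr
        exact rpow_mul_rpow_neg_mul_rpow_neg_le hr hh hτ hα hrτ
    _ = _ := by
        rw [Real.mul_rpow hC₁.le (by positivity), hgeom]
        ring

lemma isLittleO_rpow_mul_rpow {ι : Type*} {𝓕 : Filter ι} {r h τ q R g : ι → ℝ} {c κ α α' : ℝ}
    (hr : ∀ᶠ i in 𝓕, 0 < r i) (hτ : ∀ᶠ i in 𝓕, 0 < τ i) (hR : ∀ᶠ i in 𝓕, 0 < R i)
    (hq : ∀ᶠ i in 𝓕, 1 ≤ q i) (hh : Tendsto h 𝓕 atTop) (hc : 0 < c) (hκ : 0 < κ)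
    (hα : α < α') (hα' : 0 ≤ α') (hrτ : r =O[𝓕] fun i => τ i ^ (q i / 2))
    (hcR : (fun i => (c * τ i) ^ (q i / 2)) =O[𝓕] R) (hg : g =O[𝓕] fun _ => (1 : ℝ)) :
    (fun i => (r i * (1 / h i ^ q i) / R i) ^ α' * (g i * κ ^ (-(q i / 2)))) =o[𝓕]
      fun i => r i ^ α * (h i * √(τ i)) ^ (-(α * q i)) := by
  obtain ⟨C₁, hC₁, hrC₁⟩ := exists_pos_eventually_le_mul hrτ
    (hτ.mono fun i hi => Real.rpow_nonneg hi.le _)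
  obtain ⟨C₂, hC₂, hRC₂⟩ := exists_pos_eventually_le_mul hcR (hR.mono fun i hi => hi.le)
  let B i := c ^ (-(α' / 2)) * κ ^ (-(1 / 2) : ℝ) * h i ^ (-(α' - α))
  have hB0 : Tendsto B 𝓕 (𝓝 0) := by
    simpa only [mul_zero, Function.comp_def] using
      ((tendsto_rpow_neg_atTop (sub_pos.2 hα)).comp hh).const_mul
        (c ^ (-(α' / 2)) * κ ^ (-(1 / 2) : ℝ))
  have hbound : (fun i => (r i * (1 / h i ^ q i) / R i) ^ α' * κ ^ (-(q i / 2))) =O[𝓕]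
      fun i => B i * (r i ^ α * (h i * √(τ i)) ^ (-(α * q i))) := by
    refine .of_bound (C₁ ^ (α' - α) * C₂ ^ α') ?_
    filter_upwards [hr, hτ, hR, hq, hh.eventually_gt_atTop 0, hrC₁, hRC₂,
      hB0.eventually_le_const one_pos] with i hr hτ hR hq hh hrC hRC hB1
    rw [Real.norm_of_nonneg (by positivity), Real.norm_of_nonneg (by positivity), ← mul_assoc]
    refine (rpow_mul_rpow_le_rate hr hh hτ hR hc hC₁ hC₂ hκ hα.le hα' hrC hRC).trans ?_
    gcongr
    exact Real.rpow_le_self_of_le_one (by positivity) hB1 hq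
  refine (hg.mul_isLittleO (hbound.trans_isLittleO
    (((isLittleO_one_iff ℝ).2 hB0).mul_isBigO (isBigO_refl _ 𝓕)))).congr (fun i => ?_) fun i => ?_
  · exact mul_left_comm _ _ _
  · rw [one_mul, one_mul]

lemma isBigO_exp_mul_div {ι : Type*} {𝓕 : Filter ι} {f g : ι → ℝ} (hfg : f =O[𝓕] g) (A B : ℝ) :
    (fun i => Real.exp (A * (B * (f i / g i)) / 2)) =O[𝓕] fun _ => (1 : ℝ) := by
  have hdiv : (fun i => f i / g i) =O[𝓕] fun _ => (1 : ℝ) :=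
    (isBigO_one_iff ℝ).2 (div_isBoundedUnder_of_isBigO hfg)
  have hexponent : (fun i => A * (B * (f i / g i)) / 2) =O[𝓕] fun _ => (1 : ℝ) := by
    simpa only [div_eq_inv_mul _ (2 : ℝ)] using
      ((hdiv.const_mul_left B).const_mul_left A).const_mul_left (2⁻¹ : ℝ)
  exact Real.isBigO_exp_comp_one.2 (((isBigO_one_iff ℝ).1 hexponent).mono_le
    (.of_forall fun _ => Real.le_norm_self _))

end Rate

section Sequence

variable {P : (n : ℕ) → Problem n}

lemma isLittleO_card_m (hP : ∀ᶠ n in atTop, (P n).IsAdmissible)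
    (hsize : (fun n => ((P n).pbar : ℝ)) =o[atTop] fun n => min (n : ℝ) ((P n).p : ℝ)) :
    (fun n => ((P n).m.card : ℝ)) =o[atTop] fun n => (n : ℝ) := by
  have hcard : (fun n => ((P n).m.card : ℝ)) =O[atTop] fun n => ((P n).pbar : ℝ) := by
    refine .of_norm_eventuallyLE (hP.mono fun n hn => ?_)
    exact (Real.norm_natCast _).trans_le (Nat.cast_le.2 (Finset.le_sup (f := Finset.card) hn.m_mem))
  have hmin (n : ℕ) : ‖min (n : ℝ) ((P n).p : ℝ)‖ ≤ ‖(n : ℝ)‖ := by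
    rw [Real.norm_of_nonneg (by positivity), Real.norm_of_nonneg (by positivity)]
    exact min_le_left _ _
  exact (hcard.trans_isLittleO hsize).trans_le hmin

lemma isBigO_rpow_excess (hP : ∀ᶠ n in atTop, (P n).IsAdmissible)
    (hτ : Tendsto (fun n => (P n).τ) atTop atTop) {β : ℝ} (hβ : β ≤ 1) :
    (fun n => (P n).τ ^ (β * (P n).excess / 2)) =O[atTop]
      fun n => (P n).τ ^ ((P n).excess / 2) := by
  refine .of_norm_eventuallyLE ?_
  filter_upwards [hP, hτ.eventually_ge_atTop 1] with n hn hτ1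
  rw [Real.norm_of_nonneg (by positivity)]
  gcongr
  exact mul_le_of_le_one_left (zero_le_one.trans hn.one_le_excess) hβ

lemma isBigO_rate_max (hP : ∀ᶠ n in atTop, (P n).IsAdmissible) {h : ℕ → ℝ}
    (hh : Tendsto h atTop atTop) (α : ℝ) (g : ℕ → ℝ) :
    (fun n => (P n).r ^ α * (h n * √(P n).τ) ^ (-(α * (P n).excess))) =O[atTop]
      fun n => max ((P n).r ^ α * (h n * √(P n).τ) ^ (-(α * (P n).excess))) (g n) := by
  refine .of_norm_eventuallyLE ?_
  filter_upwards [hP, hh.eventually_ge_atTop 0] with n hn hhn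
  have := hn.r_pos
  rw [Real.norm_of_nonneg (by positivity)]
  exact le_max_left _ _

end Sequence

end MomSelection

end

theorem proposition5_general {aφ lφ : ℝ} (haφ : 0 < aφ) (hlφ : 0 < lφ)
    {P : (n : ℕ) → MomSelection.Problem n} {h : ℕ → ℝ}
    (hP : ∀ᶠ n in Filter.atTop, (P n).IsAdmissible)
    (hh : Filter.Tendsto h Filter.atTop Filter.atTop)
    (hcard : (fun n => ((P n).m.card : ℝ)) =o[Filter.atTop] fun n => (n : ℝ))
    (hr : (fun n => (P n).r) =O[Filter.atTop] fun n => (P n).τ ^ ((P n).excess / 2))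
    {c : ℝ} (hc : 0 < c)
    (hE : (fun n => (c * (P n).τ) ^ ((P n).excess / 2)) =O[Filter.atTop] fun n =>
      MomSelection.eigProd (P n).X (P n).m (P n).τ / MomSelection.eigProd (P n).X (P n).t (P n).τ)
    (hmean : (fun n => (P n).noncentrality) =O[Filter.atTop]
      fun n => (P n).τ * MomSelection.minEig (P n).X (P n).t)
    {α : ℝ} (hα0 : 0 < α) (hα1 : α < 1) :
    ∃ b : ℕ → ℝ,
      b =o[Filter.atTop]
        (fun n => (P n).r ^ α * (h n * Real.sqrt (P n).τ) ^ (-(α * (P n).excess))) ∧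
      ∀ᶠ n in Filter.atTop,
        ∫ y, MomSelection.postProb (P n).X (P n).m (P n).models (P n).prior
            (P n).τ aφ lφ y ∂(P n).law ≤
          b n + (P n).law.real {y | 1 / h n ^ (P n).excess <
            MomSelection.penaltyRatio (P n).X (P n).m (P n).t (P n).τ aφ lφ y} := by
  obtain ⟨α', hαα', hα'1⟩ := exists_between hα1
  obtain ⟨θ, hα'θ, hθ1⟩ := exists_between hα'1
  have hα'0 := hα0.trans hαα'
  have hθ0 := hα'0.trans hα'θ
  obtain ⟨δ, hδ, hδθ⟩ : ∃ δ, 0 < δ ∧ θ * (1 + δ) < 1 := ⟨(1 - θ) / 2, by linarith, by nlinarith⟩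
  refine ⟨_, MomSelection.isLittleO_rpow_mul_rpow (hP.mono fun n hn => hn.r_pos)
    (hP.mono fun n hn => hn.tau_pos) (hP.mono fun n hn => hn.eigProd_div_eigProd_pos)
    (hP.mono fun n hn => hn.one_le_excess) hh hc (sub_pos.2 hδθ) hαα' hα'0.le hr hE
    (MomSelection.isBigO_exp_mul_div hmean θ (1 + 1 / δ)), ?_⟩
  filter_upwards [hP, hh.eventually_ge_atTop 0,
    MomSelection.eventually_two_mul_div_add_le hcard aφ hθ0 hα'θ] with n hn hhn hd
  exact hn.integral_postProb_le haφ hlφ (by positivity) hα'0.le hα'1.le hθ0 hθ1.le hδ hδθ hd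

theorem proposition5
    -- the fixed parameters of the inverse gamma prior on the error variance
    (aφ lφ : ℝ) (haφ : 0 < aφ) (hlφ : 0 < lφ)
    -- one problem for each sample size, and the acceleration factor
    (P : (n : ℕ) → MomSelection.Problem n) (h : ℕ → ℝ)
    (hP : ∀ᶠ n in Filter.atTop, (P n).IsAdmissible)
    (hh : Filter.Tendsto h Filter.atTop Filter.atTop)
    -- (B1)
    (hB1_size : (fun n => ((P n).pbar : ℝ)) =o[Filter.atTop]
      fun n => min (n : ℝ) ((P n).p : ℝ))
    (hB1_tau : (fun n => ((P n).pbar : ℝ)) =o[Filter.atTop] fun n => (P n).τ)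
    -- (C1)
    (hC1_tau : Filter.Tendsto (fun n => (P n).τ) Filter.atTop Filter.atTop)
    (hC1_prior : ∃ β : ℝ, 0 < β ∧ β < 1 ∧
      (fun n => (P n).r) =o[Filter.atTop] fun n => (P n).τ ^ (β * (P n).excess / 2))
    -- (D1)
    (hD1 : ∃ c : ℝ, 0 < c ∧
      (fun n => MomSelection.eigProd (P n).X (P n).m (P n).τ /
        MomSelection.eigProd (P n).X (P n).t (P n).τ) =Θ[Filter.atTop]
      fun n => (c * (P n).τ) ^ ((P n).excess / 2))
    -- (D2)
    (hD2 : (fun n => (P n).noncentrality) =o[Filter.atTop]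
      fun n => (P n).τ * MomSelection.minEig (P n).X (P n).t)
    (α κ : ℝ) (hα0 : 0 < α) (hα1 : α < 1) (hκ : 0 < κ) :
    ∃ b : ℕ → ℝ,
      b =o[Filter.atTop] (fun n =>
        max ((P n).r ^ α * (h n * Real.sqrt (P n).τ) ^ (-(α * (P n).excess)))
          (max (Real.exp (-(κ * n)))
            (Real.exp (-((P n).τ * MomSelection.minEig (P n).X (P n).t / 2))))) ∧
      ∀ᶠ n in Filter.atTop,
        ∫ y, MomSelection.postProb (P n).X (P n).m (P n).models (P n).prior
            (P n).τ aφ lφ y ∂(P n).law ≤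
          b n + (P n).law.real {y | 1 / h n ^ (P n).excess <
            MomSelection.penaltyRatio (P n).X (P n).m (P n).t (P n).τ aφ lφ y} := by
  obtain ⟨β, _, hβ1, hr⟩ := hC1_prior
  obtain ⟨c, hc, hE⟩ := hD1
  exact (proposition5_general haφ hlφ hP hh (MomSelection.isLittleO_card_m hP hB1_size)
    (hr.isBigO.trans (MomSelection.isBigO_rpow_excess hP hC1_tau hβ1.le)) hc hE.2 hD2.isBigO
    hα0 hα1).imp fun b hb => ⟨hb.1.trans_isBigO (MomSelection.isBigO_rate_max hP hh α _), hb.2⟩
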